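/- Let $d\ge 1$ be an integer. For $k\in\mathbb N_0$ let $h_k(x)=(2^k k!\sqrt\pi)^{-1/2}(-1)^k e^{x^2/2}\big(\tfrac{d}{dx}\big)^k e^{-x^2}$ be the $k$-th Hermite function on $\mathbb R$, and for a multi-index $a\in\mathbb N_0^d$ put $h_a(x)=\prod_{j=1}^d h_{a_j}(x_j)$ and $|a|=\sum_j a_j$. For $q\in\mathbb N_0$ let $$\mathscr S_q=\Big\{f\in L^2(\mathbb R^d;\mathbb R)\;:\;|f|_q^2:=\sum_{a\in\mathbb N_0^d}(2|a|+d)^{2q}\,|(f,h_a)_{L^2}|^2<\infty\Big\},$$ with the norm $|\cdot|_q$. For $\alpha\in\mathbb R$ and $m>0$ let the Matérn kernel $k_{\alpha,m}=\mathscr F^{-1}(\hat k_{\alpha,m})\in\mathscr S'(\mathbb R^d)$ be the inverse Fourier transform, in the sense of tempered distributions, of $\hat k_{\alpha,m}(\xi)=(|\xi|^2+m^2)^{-\alpha}$, where on Schwartz functions $\mathscr F^{-1}\varphi(x)=(2\pi)^{-d}\int_{\mathbb R^d}e^{i\xi\cdot x}\varphi(\xi)\,d\xi$. Write $\tau_y$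 for translation, $(\tau_y g)(x)=g(x-y)$, and $g^\vee(x)=g(-x)$ for reflection, both extended to tempered distributions by duality; a tempered distribution lies in $\mathscr S_q$ if it is given by integration against an element of $\mathscr S_q$. Let $q\in\mathbb N_0$, $\alpha\in\mathbb R$, $m>0$, and consider the statements (i) $\alpha>\frac d4+q+\max\{0,\frac{q-3}{2}\}$. (ii) For every $y\in\mathbb R^d$ the translate $\tau_y(k_{\alpha,m}^\vee)$ lies in $\mathscr S_q$, and the map $\mathbb R^d\to(\mathscr S_q,|\cdot|_q)$, $y\mapsto\tau_y(k_{\alpha,m}^\vee)$, is continuous. (iii) For every $y\in\mathbb R^d$ the translate $\tau_y(k_{\alpha,m}^\vee)$ lies in $\mathscr S_q$. (iv) $\alpha>\frac d4+q$. Then (i) implies (ii), (ii) implies (iii), and (iii) implies (iv). In particular, if $q\in\{0,1,2,3\}$, then (ii), (iii) and (iv) are equivalent. -/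

import Mathlib

open MeasureTheory SchwartzMap
open scoped FourierTransform

noncomputable section

namespace MaternHermite

/-- `ℝᵈ` with its Euclidean structure. -/
abbrev Rd (d : ℕ) : Type := EuclideanSpace ℝ (Fin d)

/-! ### Hermite functions -/

/-- The `k`-th Hermite function on `ℝ`,
`h_k(x) = (2^k k! √π)^{-1/2} (-1)^k e^{x²/2} (d/dx)^k e^{-x²}`. -/
def hermiteFun (k : ℕ) (x : ℝ) : ℝ :=
  (Real.sqrt (2 ^ k * (k.factorial : ℝ) * Real.sqrt Real.pi))⁻¹ * (-1) ^ k *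
    Real.exp (x ^ 2 / 2) * iteratedDeriv k (fun t : ℝ => Real.exp (-t ^ 2)) x

/-- The tensorized Hermite function `h_a(x) = ∏ⱼ h_{aⱼ}(xⱼ)` on `ℝᵈ`, for a multi-index `a`. -/
def hermiteTensor {d : ℕ} (a : Fin d → ℕ) (x : Rd d) : ℝ :=
  ∏ j, hermiteFun (a j) (x j)

lemma iteratedDeriv_gauss (k : ℕ) :
    ∃ P : Polynomial ℝ, iteratedDeriv k (fun t : ℝ => Real.exp (-t ^ 2)) =
      fun t => P.eval t * Real.exp (-t ^ 2) := by
  induction k with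
  | zero => exact ⟨1, by simp⟩
  | succ k ih =>
    obtain ⟨P, hP⟩ := ih
    refine ⟨P.derivative - 2 * Polynomial.X * P, ?_⟩
    rw [iteratedDeriv_succ, hP]
    funext t
    have h1 : HasDerivAt (fun t : ℝ => Real.exp (-t ^ 2)) (Real.exp (-t ^ 2) * (-(2 * t))) t := by
      have := ((hasDerivAt_pow 2 t).neg).exp
      simpa using this
    have h2 := (P.hasDerivAt t).mul h1
    have h3 : deriv (fun t => P.eval t * Real.exp (-t ^ 2)) t = _ := h2.deriv
    rw [h3]
    simp
    ring

lemma hermiteFun_eq (k : ℕ) :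
    ∃ P : Polynomial ℝ, hermiteFun k = fun x => P.eval x * Real.exp (-x ^ 2 / 2) := by
  obtain ⟨P, hP⟩ := iteratedDeriv_gauss k
  refine ⟨Polynomial.C ((Real.sqrt (2 ^ k * (k.factorial : ℝ) * Real.sqrt Real.pi))⁻¹ *
    (-1) ^ k) * P, ?_⟩
  funext x
  have : Real.exp (-x ^ 2 / 2) = Real.exp (x ^ 2 / 2) * Real.exp (-x ^ 2) := by
    rw [← Real.exp_add]; congr 1; ring
  simp only [hermiteFun, hP, Polynomial.eval_mul, Polynomial.eval_C, this]
  ring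

lemma continuous_hermiteFun (k : ℕ) : Continuous (hermiteFun k) := by
  obtain ⟨P, hP⟩ := hermiteFun_eq k
  rw [hP]
  fun_prop

lemma integrable_hermiteFun_sq (k : ℕ) : Integrable (fun x => hermiteFun k x ^ 2) := by
  obtain ⟨P, hP⟩ := hermiteFun_eq k
  have h : (fun x => hermiteFun k x ^ 2) =
      fun x => ∑ i ∈ Finset.range ((P ^ 2).natDegree + 1),
        (P ^ 2).coeff i * (x ^ i * Real.exp (-1 * x ^ 2)) := by
    funext x
    have : Real.exp (-x ^ 2 / 2) ^ 2 = Real.exp (-1 * x ^ 2) := by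
      rw [← Real.exp_nat_mul]; congr 1; push_cast; ring
    rw [hP]
    simp only [mul_pow, this]
    rw [← Polynomial.eval_pow, Polynomial.eval_eq_sum_range, Finset.sum_mul]
    exact Finset.sum_congr rfl fun i _ => by ring
  rw [h]
  refine integrable_finsetSum _ fun i _ => Integrable.const_mul ?_ _
  have := integrable_rpow_mul_exp_neg_mul_sq (b := 1) one_pos (s := (i : ℝ))
    (by have : (0 : ℝ) ≤ i := Nat.cast_nonneg i
        linarith)
  simpa only [Real.rpow_natCast] using this

lemma memLp_hermiteTensor {d : ℕ} (a : Fin d → ℕ) :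
    MemLp (hermiteTensor a) 2 (volume : Measure (Rd d)) := by
  have hc : Continuous (hermiteTensor a) :=
    continuous_finsetProd _ fun j _ => (continuous_hermiteFun (a j)).comp (by fun_prop)
  rw [memLp_two_iff_integrable_sq hc.aestronglyMeasurable]
  have h := Integrable.fintype_prod (f := fun (j : Fin d) (x : ℝ) => hermiteFun (a j) x ^ 2)
    (μ := fun _ => volume) fun j => integrable_hermiteFun_sq (a j)
  have h2 := ((EuclideanSpace.volume_preserving_symm_measurableEquiv_toLp (Fin d)).integrable_comp_emb
    (MeasurableEquiv.measurableEmbedding _)).2 h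
  refine h2.congr (Filter.Eventually.of_forall fun x => ?_)
  simp [hermiteTensor, Finset.prod_pow]

/-- `h_a` as an element of the real Hilbert space `L²(ℝᵈ)`. -/
def hermiteL2 {d : ℕ} (a : Fin d → ℕ) : Lp ℝ 2 (volume : Measure (Rd d)) :=
  (memLp_hermiteTensor a).toLp (hermiteTensor a)

/-- The Hermite coefficient `(f, h_a)`, an inner product in `L²(ℝᵈ)`. -/
def hermiteCoeff {d : ℕ} (a : Fin d → ℕ) (f : Lp ℝ 2 (volume : Measure (Rd d))) : ℝ :=
  inner ℝ f (hermiteL2 a)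

/-- The eigenvalue `2|a| + d` of the harmonic oscillator `|x|² - Δ` belonging to `h_a`. -/
def hermiteWeight {d : ℕ} (a : Fin d → ℕ) : ℝ := 2 * (∑ j, (a j : ℝ)) + d

/-! ### The spaces `𝒮_q` -/

lemma summable_mul_of_sq {ι : Type*} {u v : ι → ℝ} {w : ι → ℝ} (hw : ∀ i, 0 ≤ w i)
    (hu : Summable fun i => w i * u i ^ 2) (hv : Summable fun i => w i * v i ^ 2) :
    Summable fun i => w i * (u i * v i) := by
  refine Summable.of_norm_bounded (hu.add hv) fun i => ?_
  rw [Real.norm_eq_abs, abs_mul, abs_of_nonneg (hw i), ← mul_add]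
  refine mul_le_mul_of_nonneg_left ?_ (hw i)
  rw [abs_le]
  constructor <;> nlinarith [sq_nonneg (u i + v i), sq_nonneg (u i - v i), sq_nonneg (u i),
    sq_nonneg (v i)]

lemma hermiteWeight_nonneg {d : ℕ} (q : ℕ) (a : Fin d → ℕ) :
    0 ≤ hermiteWeight a ^ (2 * q) := by
  unfold hermiteWeight
  positivity

/-- `𝒮_q` as a linear subspace of the real Hilbert space `L²(ℝᵈ)`: all `f` such that
`∑_a (2|a| + d)^{2q} |(f, h_a)|² < ∞`. -/
def hermiteSubmodule (d q : ℕ) : Submodule ℝ (Lp ℝ 2 (volume : Measure (Rd d))) where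
  carrier := {f | Summable fun a : Fin d → ℕ => hermiteWeight a ^ (2 * q) * hermiteCoeff a f ^ 2}
  zero_mem' := by simp [hermiteCoeff]
  add_mem' := by
    intro f g hf hg
    have hfg := summable_mul_of_sq (hermiteWeight_nonneg q) hf hg
    refine ((hf.add hg).add (hfg.mul_left 2)).congr fun a => ?_
    simp only [hermiteCoeff, inner_add_left]
    ring
  smul_mem' := by
    intro c f hf
    refine (hf.mul_left (c ^ 2)).congr fun a => ?_
    simp only [hermiteCoeff, real_inner_smul_left]
    ring

/-- The space `𝒮_q(ℝᵈ)`. This copy of `hermiteSubmodule d q` carries the norm `|·|_q` defined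
below, and not the norm of `L²(ℝᵈ)`. -/
def HermiteSobolev (d q : ℕ) : Type := hermiteSubmodule d q

instance (d q : ℕ) : AddCommGroup (HermiteSobolev d q) :=
  inferInstanceAs (AddCommGroup (hermiteSubmodule d q))

instance (d q : ℕ) : Module ℝ (HermiteSobolev d q) :=
  inferInstanceAs (Module ℝ (hermiteSubmodule d q))

/-- The underlying element of `L²(ℝᵈ)`. -/
def HermiteSobolev.toL2 {d q : ℕ} : HermiteSobolev d q →ₗ[ℝ] Lp ℝ 2 (volume : Measure (Rd d)) :=
  (hermiteSubmodule d q).subtype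

lemma HermiteSobolev.summable {d q : ℕ} (f : HermiteSobolev d q) :
    Summable fun a : Fin d → ℕ => hermiteWeight a ^ (2 * q) * hermiteCoeff a f.toL2 ^ 2 :=
  f.2

/-- The inner product `(f, g)_q = ∑_a (2|a| + d)^{2q} (f, h_a) (h_a, g)`. -/
@[reducible]
def HermiteSobolev.core (d q : ℕ) : PreInnerProductSpace.Core ℝ (HermiteSobolev d q) where
  inner f g := ∑' a : Fin d → ℕ,
    hermiteWeight a ^ (2 * q) * (hermiteCoeff a f.toL2 * hermiteCoeff a g.toL2)
  conj_inner_symm f g := by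
    simp only [conj_trivial]
    exact tsum_congr fun a => by ring
  re_inner_nonneg f := by
    refine tsum_nonneg fun a => ?_
    exact mul_nonneg (hermiteWeight_nonneg q a) (mul_self_nonneg _)
  add_left f g h := by
    rw [← Summable.tsum_add
      (summable_mul_of_sq (hermiteWeight_nonneg q) f.summable h.summable)
      (summable_mul_of_sq (hermiteWeight_nonneg q) g.summable h.summable)]
    refine tsum_congr fun a => ?_
    simp only [hermiteCoeff, map_add, inner_add_left]
    ring
  smul_left f g c := by
    simp only [conj_trivial]
    rw [← tsum_mul_left]
    refine tsum_congr fun a => ?_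
    simp only [hermiteCoeff, map_smul, real_inner_smul_left]
    ring

/-- The norm `|·|_q` that belongs to `(·, ·)_q`. (It separates points because the `h_a` form an
orthonormal basis of `L²(ℝᵈ)`; the topology does not need this fact.) -/
instance (d q : ℕ) : SeminormedAddCommGroup (HermiteSobolev d q) :=
  @InnerProductSpace.Core.toSeminormedAddCommGroup ℝ (HermiteSobolev d q) _ _ _
    (HermiteSobolev.core d q)

/-- `|f|_q² = ∑_a (2|a| + d)^{2q} |(f, h_a)|²`. -/
lemma HermiteSobolev.norm_sq {d q : ℕ} (f : HermiteSobolev d q) :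
    ‖f‖ ^ 2 = ∑' a : Fin d → ℕ, hermiteWeight a ^ (2 * q) * hermiteCoeff a f.toL2 ^ 2 := by
  have h : ‖f‖ = Real.sqrt (∑' a : Fin d → ℕ,
    hermiteWeight a ^ (2 * q) * (hermiteCoeff a f.toL2 * hermiteCoeff a f.toL2)) := rfl
  rw [h, Real.sq_sqrt (tsum_nonneg fun a =>
    mul_nonneg (hermiteWeight_nonneg q a) (mul_self_nonneg _))]
  exact tsum_congr fun a => by ring

/-! ### Tempered distributions and the Matérn kernel -/

/-- Multiplication by `(2π)⁻¹` on `ℝᵈ`. -/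
def scaleInvTwoPi (d : ℕ) : Rd d ≃L[ℝ] Rd d :=
  ContinuousLinearEquiv.smulLeft (Units.mk0 (2 * Real.pi)⁻¹ (by positivity))

/-- The inverse Fourier transform on Schwartz functions in the convention
`(ℱ⁻¹ φ)(x) = (2π)^{-d} ∫ e^{i ξ·x} φ(ξ) dξ`; see `fourierInvSchwartz_apply`. -/
def fourierInvSchwartz (d : ℕ) : 𝓢(Rd d, ℂ) →L[ℂ] 𝓢(Rd d, ℂ) :=
  (((2 * Real.pi) ^ d : ℝ) : ℂ)⁻¹ •
    (compCLMOfContinuousLinearEquiv ℂ (scaleInvTwoPi d)) ∘L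
      (FourierTransform.fourierInvCLM ℂ 𝓢(Rd d, ℂ))

lemma fourierInvSchwartz_apply {d : ℕ} (φ : 𝓢(Rd d, ℂ)) (x : Rd d) :
    fourierInvSchwartz d φ x = (((2 * Real.pi) ^ d : ℝ) : ℂ)⁻¹ *
      ∫ ξ : Rd d, Complex.exp (Complex.I * ((inner ℝ ξ x : ℝ) : ℂ)) * φ ξ := by
  have h : fourierInvSchwartz d φ x = (((2 * Real.pi) ^ d : ℝ) : ℂ)⁻¹ *
      (𝓕⁻ φ) ((2 * Real.pi)⁻¹ • x) := rfl
  rw [h, fourierInv_coe, Real.fourierInv_eq']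
  congr 1
  refine integral_congr_ae (Filter.Eventually.of_forall fun ξ => ?_)
  simp only [smul_eq_mul, real_inner_smul_right]
  congr 2
  have hpi : (Real.pi : ℂ) ≠ 0 := by exact_mod_cast Real.pi_ne_zero
  push_cast
  field_simp

/-- The inverse Fourier transform on tempered distributions: `⟨ℱ⁻¹ u, φ⟩ = ⟨u, ℱ⁻¹ φ⟩`. -/
def fourierInvDistr {d : ℕ} (u : 𝓢'(Rd d, ℂ)) : 𝓢'(Rd d, ℂ) :=
  PointwiseConvergenceCLM.precomp ℂ (fourierInvSchwartz d) u

/-- The reflection `u^∨` of a tempered distribution: `⟨u^∨, φ⟩ = ⟨u, φ(-·)⟩`. -/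
def reflect {d : ℕ} (u : 𝓢'(Rd d, ℂ)) : 𝓢'(Rd d, ℂ) :=
  PointwiseConvergenceCLM.precomp ℂ
    (compCLMOfContinuousLinearEquiv ℂ (ContinuousLinearEquiv.neg ℝ : Rd d ≃L[ℝ] Rd d)) u

/-- The translation `τ_y u` of a tempered distribution: `⟨τ_y u, φ⟩ = ⟨u, φ(· + y)⟩`. For a
function `g` this is `(τ_y g)(x) = g(x - y)`. -/
def translate {d : ℕ} (y : Rd d) (u : 𝓢'(Rd d, ℂ)) : 𝓢'(Rd d, ℂ) :=
  PointwiseConvergenceCLM.precomp ℂ (compSubConstCLM ℂ (-y)) u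

/-- The function `ξ ↦ 1 / (|ξ|² + m²)^α`. -/
def maternSymbol (d : ℕ) (α m : ℝ) (ξ : Rd d) : ℂ :=
  ((1 / (‖ξ‖ ^ 2 + m ^ 2) ^ α : ℝ) : ℂ)

lemma maternSymbol_hasTemperateGrowth (d : ℕ) (α : ℝ) {m : ℝ} (hm : 0 < m) :
    (maternSymbol d α m).HasTemperateGrowth := by
  have h1 : (fun ξ : Rd d => (1 + ‖m⁻¹ • ξ‖ ^ 2) ^ (-α)).HasTemperateGrowth :=
    (Function.hasTemperateGrowth_one_add_norm_sq_rpow (Rd d) (-α)).comp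
      (m⁻¹ • ContinuousLinearMap.id ℝ (Rd d)).hasTemperateGrowth
  have h2 := Function.Complex.hasTemperateGrowth_ofReal.comp
    ((Function.HasTemperateGrowth.const ((m ^ 2) ^ (-α))).mul h1)
  suffices h : maternSymbol d α m = Complex.ofReal ∘
      ((fun _ => (m ^ 2) ^ (-α)) * fun ξ : Rd d => (1 + ‖m⁻¹ • ξ‖ ^ 2) ^ (-α)) by
    rw [h]
    exact h2
  funext ξ
  simp only [maternSymbol, Function.comp]
  congr 1
  have h3 : ‖ξ‖ ^ 2 + m ^ 2 = m ^ 2 * (1 + ‖m⁻¹ • ξ‖ ^ 2) := by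
    rw [norm_smul, norm_inv, Real.norm_of_nonneg hm.le]
    field_simp
    ring
  rw [one_div, ← Real.rpow_neg (by positivity), h3, Real.mul_rpow (by positivity) (by positivity)]
  rfl

/-- The Matérn kernel `k_{α,m} = ℱ⁻¹ (ξ ↦ 1 / (|ξ|² + m²)^α)`, a tempered distribution. -/
def maternKernel (d : ℕ) (α m : ℝ) (hm : 0 < m) : 𝓢'(Rd d, ℂ) :=
  fourierInvDistr ((maternSymbol_hasTemperateGrowth d α hm).toTemperedDistribution volume)

/-- The tempered distribution `u` is (given by integration against) the function `f ∈ 𝒮_q`. -/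
def IsRepresentedBy {d q : ℕ} (u : 𝓢'(Rd d, ℂ)) (f : HermiteSobolev d q) : Prop :=
  ∀ φ : 𝓢(Rd d, ℂ), u φ = ∫ x : Rd d, φ x * ((f.toL2 x : ℝ) : ℂ)

/-- For every `y` the translate `τ_y(k_{α,m}^∨)` lies in `𝒮_q`. -/
def TranslatesMem (d q : ℕ) (α m : ℝ) (hm : 0 < m) : Prop :=
  ∀ y : Rd d, ∃ f : HermiteSobolev d q,
    IsRepresentedBy (translate y (reflect (maternKernel d α m hm))) f

/-- For every `y` the translate `τ_y(k_{α,m}^∨)` lies in `𝒮_q`, and `y ↦ τ_y(k_{α,m}^∨)` is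
continuous from `ℝᵈ` into `(𝒮_q, |·|_q)`. -/
def TranslatesContinuous (d q : ℕ) (α m : ℝ) (hm : 0 < m) : Prop :=
  ∃ F : Rd d → HermiteSobolev d q,
    (∀ y : Rd d, IsRepresentedBy (translate y (reflect (maternKernel d α m hm))) (F y)) ∧
      Continuous F

end MaternHermite

end

noncomputable section

namespace MaternHermite

open scoped LineDeriv Topology

/-! ### One-dimensional Hermite functions -/

/-! The weight `(2|a| + d)^q` is the eigenvalue on `h_a` of the `q`-th power of the harmonic
oscillator `H = |x|² - Δ`. So `f` lies in `𝒮_q` exactly when the distribution `H^q f` is square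
integrable. In the convention used here `ℱ⁻¹` exchanges `x_j²` and `-∂_j²` and therefore commutes
with `H` (`fourierInvSchwartz_harmonic`). The question thus moves to the Fourier side: is `H^q`
applied to `u_y(ξ) = e^{-i⟨ξ,y⟩} (|ξ|² + m²)^{-α}` square integrable?

The answer is a count of orders. Multiplication by `ξ_j²` raises the order of a symbol by two. A
derivative lowers the order of a symbol by one, or falls on the phase and brings out a factor `y_j`,
which leaves the order alone. Hence `H^q u_y` has order `2q - 2α`, with bounds locally uniform in
`y`, and it is square integrable if `α > d/4 + q`. Bessel's inequality for the orthogonal system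
`ℱ⁻¹ h_a` then bounds `|·|_q` by an `L²` norm, and dominated convergence gives continuity in `y`
(`translatesContinuous_of_lt`).

Conversely, membership at `y = 0` suffices. Without a phase, `H^q u_0` equals `(|ξ|² + m²)^{q-α}`
plus a remainder two orders lower, so nothing cancels the leading term. Completeness of the Hermite
functions turns `u ∈ 𝒮_q` into an `L²` bound on `H^q u`, and square integrability of the leading
term at infinity forces `α > d/4 + q` (`lt_of_translatesMem`).

So (iv) already gives (ii) for every `q`, and the three statements (ii), (iii), (iv) form a circle;
(i) enters only because it is at least as strong as (iv). -/

lemma contDiff_gauss (n : WithTop ℕ∞) : ContDiff ℝ n (fun t : ℝ => Real.exp (-t ^ 2)) :=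
  Real.contDiff_exp.comp (contDiff_id.pow 2).neg

lemma hasDerivAt_iteratedDeriv_gauss (k : ℕ) (x : ℝ) :
    HasDerivAt (iteratedDeriv k (fun t : ℝ => Real.exp (-t ^ 2)))
      (iteratedDeriv (k + 1) (fun t : ℝ => Real.exp (-t ^ 2)) x) x := by
  have h := (contDiff_gauss (k + 1)).differentiable_iteratedDeriv k (by exact_mod_cast Nat.lt_succ_self k)
  rw [iteratedDeriv_succ]
  exact (h x).hasDerivAt

lemma iteratedDeriv_gauss_one (x : ℝ) :
    iteratedDeriv 1 (fun t : ℝ => Real.exp (-t ^ 2)) x =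
      -2 * x * iteratedDeriv 0 (fun t : ℝ => Real.exp (-t ^ 2)) x := by
  rw [iteratedDeriv_one, iteratedDeriv_zero]
  have := ((hasDerivAt_pow 2 x).neg).exp
  refine (this.deriv).trans ?_
  simp
  ring

/-- This is the Hermite three-term recurrence: start from `g' = -2x g` and differentiate each
instance to obtain the next. -/
lemma iteratedDeriv_gauss_add_two (k : ℕ) (x : ℝ) :
    iteratedDeriv (k + 2) (fun t : ℝ => Real.exp (-t ^ 2)) x =
      -2 * x * iteratedDeriv (k + 1) (fun t : ℝ => Real.exp (-t ^ 2)) x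
        - 2 * (k + 1) * iteratedDeriv k (fun t : ℝ => Real.exp (-t ^ 2)) x := by
  induction k generalizing x with
  | zero =>
    have h0 := hasDerivAt_iteratedDeriv_gauss 0 x
    have h1 : HasDerivAt (iteratedDeriv 1 (fun t : ℝ => Real.exp (-t ^ 2)))
        (-2 * iteratedDeriv 0 (fun t : ℝ => Real.exp (-t ^ 2)) x +
          -2 * x * iteratedDeriv 1 (fun t : ℝ => Real.exp (-t ^ 2)) x) x := by
      have := ((hasDerivAt_id x).const_mul (-2)).mul h0
      refine (this.congr_deriv (by simp)).congr_of_eventuallyEq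
        (Filter.Eventually.of_forall fun t => ?_)
      simpa using iteratedDeriv_gauss_one t
    rw [(hasDerivAt_iteratedDeriv_gauss 1 x).unique h1]
    push_cast
    ring
  | succ k ih =>
    have h0 := hasDerivAt_iteratedDeriv_gauss k x
    have h1 := hasDerivAt_iteratedDeriv_gauss (k + 1) x
    have h2 := (((hasDerivAt_id x).const_mul (-2)).mul h1).sub (h0.const_mul (2 * ((k : ℝ) + 1)))
    have h3 := (h2.congr_of_eventuallyEq (f₁ := iteratedDeriv (k + 2) (fun t : ℝ => Real.exp (-t ^ 2)))
      (Filter.Eventually.of_forall fun t => by simpa using ih t)).unique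
      (hasDerivAt_iteratedDeriv_gauss (k + 2) x)
    rw [← h3]
    push_cast
    simp only [id]
    ring

lemma hermiteNorm_succ (k : ℕ) :
    Real.sqrt (2 ^ (k + 1) * ((k + 1).factorial : ℝ) * Real.sqrt Real.pi) =
      Real.sqrt (2 * (k + 1)) * Real.sqrt (2 ^ k * (k.factorial : ℝ) * Real.sqrt Real.pi) := by
  rw [← Real.sqrt_mul (by positivity)]
  congr 1
  rw [Nat.factorial_succ]
  push_cast
  ring

lemma hermiteNorm_pos (k : ℕ) :
    0 < Real.sqrt (2 ^ k * (k.factorial : ℝ) * Real.sqrt Real.pi) := by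
  have := Real.pi_pos
  positivity

/-- The raising operator. The derivative of `e^{x²/2}` produces the term with `x`; the extra
derivative of the Gaussian produces `h_{k+1}`, with the ratio of the normalizing constants and a
sign from `(-1)^k`. -/
lemma hasDerivAt_hermiteFun (k : ℕ) (x : ℝ) :
    HasDerivAt (hermiteFun k)
      (x * hermiteFun k x - Real.sqrt (2 * (k + 1)) * hermiteFun (k + 1) x) x := by
  have h0 := hasDerivAt_iteratedDeriv_gauss k x
  have h1 : HasDerivAt (fun t : ℝ => Real.exp (t ^ 2 / 2)) (Real.exp (x ^ 2 / 2) * x) x := by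
    have := ((hasDerivAt_pow 2 x).div_const 2).exp
    exact this.congr_deriv (by simp)
  have h2 := (h1.const_mul ((Real.sqrt (2 ^ k * (k.factorial : ℝ) * Real.sqrt Real.pi))⁻¹ *
    (-1) ^ k)).mul h0
  refine h2.congr_deriv ?_
  simp only [hermiteFun, hermiteNorm_succ]
  have := hermiteNorm_pos k
  have : 0 < Real.sqrt (2 * ((k : ℝ) + 1)) := by positivity
  field_simp
  ring

lemma hermiteFun_one (x : ℝ) : Real.sqrt 2 * hermiteFun 1 x = 2 * x * hermiteFun 0 x := by
  have h := hermiteNorm_succ 0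
  have h0 := hermiteNorm_pos 0
  have h2 : 0 < Real.sqrt 2 := by positivity
  simp only [hermiteFun, iteratedDeriv_gauss_one]
  norm_num at h h0 ⊢
  field_simp

lemma hermiteFun_add_two (k : ℕ) (x : ℝ) :
    Real.sqrt (2 * (k + 2)) * hermiteFun (k + 2) x =
      2 * x * hermiteFun (k + 1) x - Real.sqrt (2 * (k + 1)) * hermiteFun k x := by
  have h := hermiteNorm_succ k
  have h' := hermiteNorm_succ (k + 1)
  have h0 := hermiteNorm_pos k
  have h2 : 0 < Real.sqrt (2 * ((k : ℝ) + 1)) := by positivity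
  have h3 : 0 < Real.sqrt (2 * ((k : ℝ) + 2)) := by positivity
  have h4 : Real.sqrt (2 * ((k : ℝ) + 1)) ^ 2 = 2 * (k + 1) := Real.sq_sqrt (by positivity)
  have h5 : ((k + 1 : ℕ) : ℝ) + 1 = k + 2 := by push_cast; ring
  rw [h5] at h'
  simp only [hermiteFun, iteratedDeriv_gauss_add_two, h', h]
  have e : (2 * ((k : ℝ) + 1)) = Real.sqrt (2 * ((k : ℝ) + 1)) ^ 2 := h4.symm
  generalize Real.sqrt (2 * ((k : ℝ) + 1)) = s at *
  rw [e]
  field_simp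
  ring

lemma hasDerivAt_hermiteFun_zero (x : ℝ) :
    HasDerivAt (hermiteFun 0) (-(x * hermiteFun 0 x)) x := by
  refine (hasDerivAt_hermiteFun 0 x).congr_deriv ?_
  have := hermiteFun_one x
  simp only [Nat.cast_zero, zero_add, mul_one]
  linarith

/-- The lowering operator: the three-term recurrence eliminates `h_{k+2}` from the raising formula.
-/
lemma hasDerivAt_hermiteFun_succ (k : ℕ) (x : ℝ) :
    HasDerivAt (hermiteFun (k + 1))
      (Real.sqrt (2 * (k + 1)) * hermiteFun k x - x * hermiteFun (k + 1) x) x := by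
  refine (hasDerivAt_hermiteFun (k + 1) x).congr_deriv ?_
  have := hermiteFun_add_two k x
  have h5 : ((k + 1 : ℕ) : ℝ) + 1 = k + 2 := by push_cast; ring
  rw [h5]
  linarith

/-- The Hermite functions are eigenfunctions of the one-dimensional harmonic oscillator. -/
lemma hasDerivAt_deriv_hermiteFun (k : ℕ) (x : ℝ) :
    HasDerivAt (fun t => t * hermiteFun k t - Real.sqrt (2 * (k + 1)) * hermiteFun (k + 1) t)
      ((x ^ 2 - (2 * k + 1)) * hermiteFun k x) x := by
  refine (((hasDerivAt_id x).mul (hasDerivAt_hermiteFun k x)).sub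
    ((hasDerivAt_hermiteFun_succ k x).const_mul (Real.sqrt (2 * (k + 1))))).congr_deriv ?_
  have h4 : Real.sqrt (2 * ((k : ℝ) + 1)) ^ 2 = 2 * (k + 1) := Real.sq_sqrt (by positivity)
  simp only [id]
  linear_combination -(hermiteFun k x) * h4

/-- The recurrence solved for `x h_k`. It serves the completeness proof, where the span of the
Hermite functions must contain all polynomials times the Gaussian. -/
lemma mul_hermiteFun_mem_span (k : ℕ) :
    (fun x => x * hermiteFun k x) ∈ Submodule.span ℝ (Set.range hermiteFun) := by
  have hm : ∀ i, hermiteFun i ∈ Submodule.span ℝ (Set.range hermiteFun) := fun i =>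
    Submodule.subset_span ⟨i, rfl⟩
  rcases k with _ | k
  · have : (fun x => x * hermiteFun 0 x) = (Real.sqrt 2 / 2) • hermiteFun 1 := by
      funext x
      have := hermiteFun_one x
      simp only [Pi.smul_apply, smul_eq_mul]
      linarith
    rw [this]
    exact Submodule.smul_mem _ _ (hm 1)
  · have : (fun x => x * hermiteFun (k + 1) x) = (Real.sqrt (2 * (k + 2)) / 2) • hermiteFun (k + 2)
        + (Real.sqrt (2 * (k + 1)) / 2) • hermiteFun k := by
      funext x
      have := hermiteFun_add_two k x
      simp only [Pi.smul_apply, smul_eq_mul, Pi.add_apply]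
      linarith
    rw [this]
    exact Submodule.add_mem _ (Submodule.smul_mem _ _ (hm _)) (Submodule.smul_mem _ _ (hm _))

lemma integrable_eval_mul_gauss (P : Polynomial ℝ) :
    Integrable (fun x => P.eval x * Real.exp (-x ^ 2)) := by
  have h : (fun x => P.eval x * Real.exp (-x ^ 2)) =
      fun x => ∑ i ∈ Finset.range (P.natDegree + 1),
        P.coeff i * (x ^ i * Real.exp (-1 * x ^ 2)) := by
    funext x
    rw [Polynomial.eval_eq_sum_range, Finset.sum_mul]
    exact Finset.sum_congr rfl fun i _ => by rw [neg_one_mul]; ring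
  rw [h]
  refine integrable_finsetSum _ fun i _ => Integrable.const_mul ?_ _
  have := integrable_rpow_mul_exp_neg_mul_sq (b := 1) one_pos (s := (i : ℝ))
    (by have : (0 : ℝ) ≤ i := Nat.cast_nonneg i
        linarith)
  simpa only [Real.rpow_natCast] using this

lemma integrable_eval_mul_hermiteFun_mul (P : Polynomial ℝ) (j k : ℕ) :
    Integrable (fun x => P.eval x * (hermiteFun j x * hermiteFun k x)) := by
  obtain ⟨A, hA⟩ := hermiteFun_eq j
  obtain ⟨B, hB⟩ := hermiteFun_eq k
  refine (integrable_eval_mul_gauss (P * (A * B))).congr (Filter.Eventually.of_forall fun x => ?_)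
  have : Real.exp (-x ^ 2) = Real.exp (-x ^ 2 / 2) * Real.exp (-x ^ 2 / 2) := by
    rw [← Real.exp_add]; congr 1; ring
  simp only [hA, hB, Polynomial.eval_mul, this]
  ring

lemma integrable_hermiteFun_mul (j k : ℕ) :
    Integrable (fun x => hermiteFun j x * hermiteFun k x) := by
  simpa using integrable_eval_mul_hermiteFun_mul 1 j k

lemma integrable_id_mul_hermiteFun_mul (j k : ℕ) :
    Integrable (fun x => x * (hermiteFun j x * hermiteFun k x)) := by
  simpa using integrable_eval_mul_hermiteFun_mul Polynomial.X j k

/-- Raising and lowering are adjoint: in the integration by parts of `h_j h_{k+1}'` the two terms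
with a factor `x` cancel. This descends along diagonals, so orthonormality reduces to the case where
one index is `0`. -/
lemma integral_hermiteFun_succ_left (j k : ℕ) :
    Real.sqrt (2 * (j + 1)) * ∫ x, hermiteFun (j + 1) x * hermiteFun (k + 1) x =
      Real.sqrt (2 * (k + 1)) * ∫ x, hermiteFun j x * hermiteFun k x := by
  have hI := integral_mul_deriv_eq_deriv_mul_of_integrable
    (u := hermiteFun j) (v := hermiteFun (k + 1))
    (u' := fun x => x * hermiteFun j x - Real.sqrt (2 * (j + 1)) * hermiteFun (j + 1) x)
    (v' := fun x => Real.sqrt (2 * (k + 1)) * hermiteFun k x - x * hermiteFun (k + 1) x)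
    (fun x _ => hasDerivAt_hermiteFun j x) (fun x _ => hasDerivAt_hermiteFun_succ k x)
    (((integrable_hermiteFun_mul j k).const_mul (Real.sqrt (2 * (k + 1)))).sub
      (integrable_id_mul_hermiteFun_mul j (k + 1)) |>.congr
      (Filter.Eventually.of_forall fun x => by simp only [Pi.mul_apply, Pi.sub_apply]; ring))
    ((integrable_id_mul_hermiteFun_mul j (k + 1)).sub
      ((integrable_hermiteFun_mul (j + 1) (k + 1)).const_mul (Real.sqrt (2 * (j + 1)))) |>.congr
      (Filter.Eventually.of_forall fun x => by simp only [Pi.mul_apply, Pi.sub_apply]; ring))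
    (integrable_hermiteFun_mul j (k + 1))
  have e1 : ∫ x, hermiteFun j x *
      (Real.sqrt (2 * (k + 1)) * hermiteFun k x - x * hermiteFun (k + 1) x) =
      Real.sqrt (2 * (k + 1)) * (∫ x, hermiteFun j x * hermiteFun k x) -
        ∫ x, x * (hermiteFun j x * hermiteFun (k + 1) x) := by
    rw [← integral_const_mul, ← integral_sub ((integrable_hermiteFun_mul j k).const_mul _)
      (integrable_id_mul_hermiteFun_mul j (k + 1))]
    exact integral_congr_ae (Filter.Eventually.of_forall fun x => by simp only []; ring)
  have e2 : ∫ x, (x * hermiteFun j x - Real.sqrt (2 * (j + 1)) * hermiteFun (j + 1) x) *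
      hermiteFun (k + 1) x = (∫ x, x * (hermiteFun j x * hermiteFun (k + 1) x)) -
      Real.sqrt (2 * (j + 1)) * ∫ x, hermiteFun (j + 1) x * hermiteFun (k + 1) x := by
    rw [← integral_const_mul, ← integral_sub (integrable_id_mul_hermiteFun_mul j (k + 1))
      ((integrable_hermiteFun_mul (j + 1) (k + 1)).const_mul _)]
    exact integral_congr_ae (Filter.Eventually.of_forall fun x => by simp only []; ring)
  rw [e1, e2] at hI
  linarith

lemma integral_hermiteFun_zero_succ (k : ℕ) :
    ∫ x, hermiteFun 0 x * hermiteFun (k + 1) x = 0 := by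
  have hI := integral_mul_deriv_eq_deriv_mul_of_integrable
    (u := hermiteFun 0) (v := hermiteFun k)
    (u' := fun x => -(x * hermiteFun 0 x))
    (v' := fun x => x * hermiteFun k x - Real.sqrt (2 * (k + 1)) * hermiteFun (k + 1) x)
    (fun x _ => hasDerivAt_hermiteFun_zero x) (fun x _ => hasDerivAt_hermiteFun k x)
    ((integrable_id_mul_hermiteFun_mul 0 k).sub
      ((integrable_hermiteFun_mul 0 (k + 1)).const_mul (Real.sqrt (2 * (k + 1)))) |>.congr
      (Filter.Eventually.of_forall fun x => by simp only [Pi.mul_apply, Pi.sub_apply]; ring))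
    ((integrable_id_mul_hermiteFun_mul 0 k).neg |>.congr
      (Filter.Eventually.of_forall fun x => by simp only [Pi.mul_apply, Pi.neg_apply]; ring))
    (integrable_hermiteFun_mul 0 k)
  have e1 : ∫ x, hermiteFun 0 x *
      (x * hermiteFun k x - Real.sqrt (2 * (k + 1)) * hermiteFun (k + 1) x) =
      (∫ x, x * (hermiteFun 0 x * hermiteFun k x)) -
      Real.sqrt (2 * (k + 1)) * ∫ x, hermiteFun 0 x * hermiteFun (k + 1) x := by
    rw [← integral_const_mul, ← integral_sub (integrable_id_mul_hermiteFun_mul 0 k)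
      ((integrable_hermiteFun_mul 0 (k + 1)).const_mul _)]
    exact integral_congr_ae (Filter.Eventually.of_forall fun x => by simp only []; ring)
  have e2 : ∫ x, -(x * hermiteFun 0 x) * hermiteFun k x =
      -∫ x, x * (hermiteFun 0 x * hermiteFun k x) := by
    rw [← integral_neg]
    exact integral_congr_ae (Filter.Eventually.of_forall fun x => by simp only []; ring)
  rw [e1, e2] at hI
  have h3 : 0 < Real.sqrt (2 * ((k : ℝ) + 1)) := by positivity
  have : Real.sqrt (2 * ((k : ℝ) + 1)) * ∫ x, hermiteFun 0 x * hermiteFun (k + 1) x = 0 := by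
    linarith
  exact (mul_eq_zero.1 this).resolve_left h3.ne'

lemma hermiteFun_zero (x : ℝ) :
    hermiteFun 0 x = (Real.sqrt (Real.sqrt Real.pi))⁻¹ * Real.exp (-x ^ 2 / 2) := by
  have : Real.exp (-x ^ 2 / 2) = Real.exp (x ^ 2 / 2) * Real.exp (-x ^ 2) := by
    rw [← Real.exp_add]; congr 1; ring
  simp [hermiteFun, this, mul_assoc]

/-- The Hermite functions are orthonormal in `L²(ℝ)`. -/
lemma integral_hermiteFun_mul (j k : ℕ) :
    ∫ x, hermiteFun j x * hermiteFun k x = if j = k then 1 else 0 := by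
  induction j generalizing k with
  | zero =>
    rcases k with _ | k
    · have h0 : Real.sqrt (Real.sqrt Real.pi) ^ 2 = Real.sqrt Real.pi :=
        Real.sq_sqrt (Real.sqrt_nonneg _)
      have h1 : 0 < Real.sqrt Real.pi := Real.sqrt_pos.2 Real.pi_pos
      have h2 := integral_gaussian 1
      have h3 : ∀ x, hermiteFun 0 x * hermiteFun 0 x =
          (Real.sqrt Real.pi)⁻¹ * Real.exp (-1 * x ^ 2) := by
        intro x
        have : Real.exp (-1 * x ^ 2) = Real.exp (-x ^ 2 / 2) * Real.exp (-x ^ 2 / 2) := by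
          rw [← Real.exp_add]; congr 1; ring
        have h0' : (Real.sqrt (Real.sqrt Real.pi))⁻¹ * (Real.sqrt (Real.sqrt Real.pi))⁻¹ =
            (Real.sqrt Real.pi)⁻¹ := by rw [← mul_inv, ← sq, h0]
        rw [hermiteFun_zero, this, ← h0']
        ring
      simp only [h3, integral_const_mul, h2]
      simp [h1.ne']
    · simp [integral_hermiteFun_zero_succ]
  | succ j ih =>
    rcases k with _ | k
    · simp only [mul_comm (hermiteFun (j + 1) _)]
      simp [integral_hermiteFun_zero_succ]
    · have h := integral_hermiteFun_succ_left j k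
      rw [ih k] at h
      have h3 : 0 < Real.sqrt (2 * ((j : ℝ) + 1)) := by positivity
      by_cases hjk : j = k
      · subst hjk
        simp only [if_true] at h ⊢
        exact mul_left_cancel₀ h3.ne' h
      · simp only [hjk, if_false, mul_zero] at h
        simpa [hjk] using (mul_eq_zero.1 h).resolve_left h3.ne'

/-! ### The Gaussian and the tensorized Hermite functions as Schwartz functions -/

/-- From `s^N / N! ≤ e^s` at `s = 1 + t`; the exponent `1 + t - t²/2` is largest at `t = 1`, with
value `3/2`. -/
lemma one_add_pow_mul_exp_neg_sq_le (N : ℕ) {t : ℝ} (ht : 0 ≤ t) :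
    (1 + t) ^ N * Real.exp (-t ^ 2 / 2) ≤ N.factorial * Real.exp (3 / 2) := by
  have h1 : (1 + t) ^ N ≤ N.factorial * Real.exp (1 + t) := by
    have := Real.pow_div_factorial_le_exp (1 + t) (by linarith) N
    rwa [div_le_iff₀' (by positivity)] at this
  calc (1 + t) ^ N * Real.exp (-t ^ 2 / 2)
      ≤ (N.factorial * Real.exp (1 + t)) * Real.exp (-t ^ 2 / 2) := by gcongr
    _ = N.factorial * Real.exp (1 + t + -t ^ 2 / 2) := by rw [mul_assoc, ← Real.exp_add]
    _ ≤ N.factorial * Real.exp (3 / 2) := by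
        gcongr
        nlinarith [sq_nonneg (t - 1)]

/-- The Gaussian `x ↦ exp (-|x|²/2)` as a Schwartz function. -/
def gaussianSchwartz (d : ℕ) : 𝓢(Rd d, ℝ) where
  toFun x := Real.exp (-‖x‖ ^ 2 / 2)
  smooth' := by
    have : ContDiff ℝ (⊤ : ℕ∞) fun x : Rd d => -‖x‖ ^ 2 / 2 :=
      ((contDiff_norm_sq ℝ).neg).div_const 2
    exact Real.contDiff_exp.comp this
  decay' := by
    intro l n
    have hq : (fun x : Rd d => -‖x‖ ^ 2 / 2).HasTemperateGrowth := by
      have h := (Function.HasTemperateGrowth.const (E := Rd d) (-(1 / 2) : ℝ)).mul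
        (Function.hasTemperateGrowth_norm_sq (H := Rd d))
      have e : (fun x : Rd d => -‖x‖ ^ 2 / 2) = (fun _ => (-(1 / 2) : ℝ)) * fun x => ‖x‖ ^ 2 := by
        funext x
        simp only [Pi.mul_apply]
        ring
      rw [e]
      exact h
    obtain ⟨k, C, hC0, hC⟩ := hq.norm_iteratedFDeriv_le_uniform n
    refine ⟨n.factorial * (1 + C) ^ n * ((l + k * n).factorial * Real.exp (3 / 2)), fun x => ?_⟩
    have hx : 0 ≤ ‖x‖ := norm_nonneg x
    set D : ℝ := (1 + C) * (1 + ‖x‖) ^ k with hD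
    have hD1 : 1 ≤ D := one_le_mul_of_one_le_of_one_le (by linarith)
      (one_le_pow₀ (by linarith))
    -- Faà di Bruno bound: all derivatives of the outer exponential equal its value, and the `i`-th
    -- derivative of the quadratic is at most `D ≤ D ^ i`, because `1 ≤ D` and `1 ≤ i`.
    have h := norm_iteratedFDeriv_comp_le (𝕜 := ℝ) (g := Real.exp)
      (f := fun x : Rd d => -‖x‖ ^ 2 / 2) (n := n) (N := (⊤ : ℕ∞)) Real.contDiff_exp hq.1
      (by exact_mod_cast le_top) x (C := Real.exp (-‖x‖ ^ 2 / 2)) (D := D)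
      (fun i _ => by
        rw [norm_iteratedFDeriv_eq_norm_iteratedDeriv, iteratedDeriv_eq_iterate,
          Real.iter_deriv_exp, Real.norm_eq_abs, Real.abs_exp])
      (fun i hi1 hi => by
        refine (hC i hi x).trans (le_trans ?_ (le_self_pow₀ hD1 (by omega)))
        rw [hD]
        gcongr
        linarith)
    have hl : ‖x‖ ^ l ≤ (1 + ‖x‖) ^ l := by gcongr; linarith
    calc ‖x‖ ^ l * ‖iteratedFDeriv ℝ n (fun x : Rd d => Real.exp (-‖x‖ ^ 2 / 2)) x‖
        ≤ (1 + ‖x‖) ^ l * (n.factorial * Real.exp (-‖x‖ ^ 2 / 2) * D ^ n) := by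
          gcongr
          exact h
      _ = n.factorial * (1 + C) ^ n *
          ((1 + ‖x‖) ^ (l + k * n) * Real.exp (-‖x‖ ^ 2 / 2)) := by
          rw [hD, mul_pow, ← pow_mul, pow_add]
          ring
      _ ≤ _ := by
          exact mul_le_mul_of_nonneg_left (one_add_pow_mul_exp_neg_sq_le _ hx) (by positivity)

lemma gaussianSchwartz_apply {d : ℕ} (x : Rd d) :
    gaussianSchwartz d x = Real.exp (-‖x‖ ^ 2 / 2) := rfl

lemma hasTemperateGrowth_coord {d : ℕ} (j : Fin d) :
    (fun x : Rd d => x j).HasTemperateGrowth :=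
  (EuclideanSpace.proj (𝕜 := ℝ) j : Rd d →L[ℝ] ℝ).hasTemperateGrowth

lemma hasTemperateGrowth_polynomial_comp {E : Type*} [NormedAddCommGroup E] [NormedSpace ℝ E]
    (P : Polynomial ℝ) {f : E → ℝ} (hf : f.HasTemperateGrowth) :
    (fun x => P.eval (f x)).HasTemperateGrowth := by
  simp only [Polynomial.eval_eq_sum_range]
  exact Function.HasTemperateGrowth.sum fun i _ =>
    (Function.HasTemperateGrowth.const (P.coeff i)).mul (hf.pow i)

lemma hasTemperateGrowth_finset_prod {E ι : Type*} [NormedAddCommGroup E] [NormedSpace ℝ E]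
    (s : Finset ι) {f : ι → E → ℝ} (hf : ∀ i, (f i).HasTemperateGrowth) :
    (fun x => ∏ i ∈ s, f i x).HasTemperateGrowth := by
  classical
  induction s using Finset.induction_on with
  | empty => simp
  | insert i s hi ih =>
    simp only [Finset.prod_insert hi]
    exact (hf i).mul ih

/-- A product of polynomials in the coordinates, of temperate growth, times the Schwartz Gaussian.
-/
lemma exists_schwartz_hermiteTensor {d : ℕ} (a : Fin d → ℕ) :
    ∃ φ : 𝓢(Rd d, ℂ), ∀ x, φ x = (hermiteTensor a x : ℂ) := by
  choose P hP using fun j => hermiteFun_eq (a j)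
  have hg : (fun x : Rd d => ∏ j, (P j).eval (x j)).HasTemperateGrowth :=
    hasTemperateGrowth_finset_prod _ fun j =>
      hasTemperateGrowth_polynomial_comp (P j) (hasTemperateGrowth_coord j)
  refine ⟨(smulLeftCLM ℝ (fun x : Rd d => ∏ j, (P j).eval (x j))
    (gaussianSchwartz d)).postcompCLM Complex.ofRealCLM, fun x => ?_⟩
  rw [postcompCLM_apply, smulLeftCLM_apply_apply hg]
  simp only [Complex.ofRealCLM_apply, hermiteTensor, hP, Finset.prod_mul_distrib,
    gaussianSchwartz_apply, ← Real.exp_sum, smul_eq_mul, EuclideanSpace.norm_sq_eq,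
    Real.norm_eq_abs, sq_abs]
  rw [neg_div, Finset.sum_div, ← Finset.sum_neg_distrib]
  simp only [neg_div]

/-- The tensorized Hermite function `h_a` as a (complex valued) Schwartz function. -/
def hermiteSchwartz {d : ℕ} (a : Fin d → ℕ) : 𝓢(Rd d, ℂ) :=
  (exists_schwartz_hermiteTensor a).choose

lemma hermiteSchwartz_apply {d : ℕ} (a : Fin d → ℕ) (x : Rd d) :
    hermiteSchwartz a x = (hermiteTensor a x : ℂ) :=
  (exists_schwartz_hermiteTensor a).choose_spec x

/-! ### The harmonic oscillator on Schwartz functions -/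

/-- The `j`-th standard basis vector of `ℝᵈ`. -/
abbrev stdVec {d : ℕ} (j : Fin d) : Rd d := EuclideanSpace.single j 1

lemma inner_stdVec {d : ℕ} (x : Rd d) (j : Fin d) : inner ℝ x (stdVec j) = x j := by
  simp [stdVec, EuclideanSpace.inner_single_right]

/-- Multiplication by the `j`-th coordinate. -/
def coordMul {d : ℕ} (j : Fin d) (φ : 𝓢(Rd d, ℂ)) : 𝓢(Rd d, ℂ) :=
  smulLeftCLM ℂ (fun x : Rd d => inner ℝ x (stdVec j)) φ

lemma coordMul_apply {d : ℕ} (j : Fin d) (φ : 𝓢(Rd d, ℂ)) (x : Rd d) :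
    coordMul j φ x = (x j : ℂ) * φ x := by
  have : (fun x : Rd d => (inner ℝ x (stdVec j) : ℝ)).HasTemperateGrowth := by fun_prop
  rw [coordMul, smulLeftCLM_apply_apply this, inner_stdVec, Complex.real_smul]

/-- The harmonic oscillator `|x|² - Δ`. -/
def harmonic {d : ℕ} (φ : 𝓢(Rd d, ℂ)) : 𝓢(Rd d, ℂ) :=
  ∑ j, (coordMul j (coordMul j φ) - ∂_{stdVec j} (∂_{stdVec j} φ))

lemma schwartz_sum_apply {E ι : Type*} [NormedAddCommGroup E] [NormedSpace ℝ E]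
    (s : Finset ι) (f : ι → 𝓢(E, ℂ)) (x : E) : (∑ i ∈ s, f i) x = ∑ i ∈ s, f i x := by
  classical
  induction s using Finset.induction_on with
  | empty => simp
  | insert i s hi ih => simp [Finset.sum_insert hi, ih]

lemma harmonic_apply {d : ℕ} (φ : 𝓢(Rd d, ℂ)) (x : Rd d) :
    harmonic φ x = ∑ j, ((x j : ℂ) ^ 2 * φ x - ∂_{stdVec j} (∂_{stdVec j} φ) x) := by
  rw [harmonic, schwartz_sum_apply]
  refine Finset.sum_congr rfl fun j _ => ?_
  rw [sub_apply, coordMul_apply, coordMul_apply]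
  ring

lemma harmonic_smul {d : ℕ} (c : ℂ) (φ : 𝓢(Rd d, ℂ)) : harmonic (c • φ) = c • harmonic φ := by
  ext x
  simp only [harmonic_apply, smul_apply, LineDeriv.lineDerivOp_smul, Finset.mul_sum, smul_eq_mul]
  exact Finset.sum_congr rfl fun j _ => by ring

/-- Along the `j`-th axis only the `j`-th factor varies, so partial derivatives of tensor products
reduce to one variable. -/
lemma hasLineDerivAt_mul_prod_erase {d : ℕ} (j : Fin d) {g : ℝ → ℝ} {g' : ℝ}
    (f : Fin d → ℝ → ℝ) (x : Rd d) (hg : HasDerivAt g g' (x j)) :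
    HasLineDerivAt ℝ (fun x : Rd d => ((g (x j) * ∏ i ∈ Finset.univ.erase j, f i (x i) : ℝ) : ℂ))
      ((g' * ∏ i ∈ Finset.univ.erase j, f i (x i) : ℝ) : ℂ) x (stdVec j) := by
  unfold HasLineDerivAt
  refine HasDerivAt.ofReal_comp ?_
  have h1 : ∀ t : ℝ, (x + t • stdVec j) j = x j + t := fun t => by simp [stdVec]
  have h2 : ∀ t : ℝ, ∀ i ∈ Finset.univ.erase j, f i ((x + t • stdVec j) i) = f i (x i) :=
    fun t i hi => by simp [stdVec, (Finset.mem_erase.1 hi).1]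
  simp only [h1, fun t => Finset.prod_congr rfl (h2 t)]
  refine HasDerivAt.mul_const ?_ _
  have h3 : HasDerivAt g g' (x j + 0) := by simpa using hg
  exact h3.comp_const_add (x j) 0

lemma hermiteTensor_eq_mul_prod_erase {d : ℕ} (a : Fin d → ℕ) (j : Fin d) (x : Rd d) :
    hermiteTensor a x =
      hermiteFun (a j) (x j) * ∏ i ∈ Finset.univ.erase j, hermiteFun (a i) (x i) :=
  (Finset.mul_prod_erase _ _ (Finset.mem_univ j)).symm

lemma lineDeriv_hermiteSchwartz {d : ℕ} (a : Fin d → ℕ) (j : Fin d) (x : Rd d) :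
    ∂_{stdVec j} (hermiteSchwartz a) x =
      (((x j * hermiteFun (a j) (x j) - Real.sqrt (2 * (a j + 1)) * hermiteFun (a j + 1) (x j)) *
        ∏ i ∈ Finset.univ.erase j, hermiteFun (a i) (x i) : ℝ) : ℂ) := by
  rw [lineDerivOp_apply]
  have h := hasLineDerivAt_mul_prod_erase j (fun i => hermiteFun (a i)) x
    (hasDerivAt_hermiteFun (a j) (x j))
  rw [← h.lineDeriv]
  congr 1
  funext y
  rw [hermiteSchwartz_apply, hermiteTensor_eq_mul_prod_erase a j]

lemma lineDeriv_lineDeriv_hermiteSchwartz {d : ℕ} (a : Fin d → ℕ) (j : Fin d) (x : Rd d) :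
    ∂_{stdVec j} (∂_{stdVec j} (hermiteSchwartz a)) x =
      ((x j : ℂ) ^ 2 - (2 * a j + 1)) * hermiteSchwartz a x := by
  rw [lineDerivOp_apply]
  have h := hasLineDerivAt_mul_prod_erase j (fun i => hermiteFun (a i)) x
    (hasDerivAt_deriv_hermiteFun (a j) (x j))
  rw [hermiteSchwartz_apply, hermiteTensor_eq_mul_prod_erase a j]
  rw [show ((∂_{stdVec j} (hermiteSchwartz a) : 𝓢(Rd d, ℂ)) : Rd d → ℂ) = _ from
    funext (lineDeriv_hermiteSchwartz a j), h.lineDeriv]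
  push_cast
  ring

/-- The tensorized Hermite functions are eigenfunctions of the harmonic oscillator. -/
lemma harmonic_hermiteSchwartz {d : ℕ} (a : Fin d → ℕ) :
    harmonic (hermiteSchwartz a) = (hermiteWeight a : ℂ) • hermiteSchwartz a := by
  ext x
  simp only [harmonic_apply, lineDeriv_lineDeriv_hermiteSchwartz, smul_apply, smul_eq_mul]
  have : ∀ j, (x j : ℂ) ^ 2 * hermiteSchwartz a x -
      ((x j : ℂ) ^ 2 - (2 * a j + 1)) * hermiteSchwartz a x =
      (2 * a j + 1) * hermiteSchwartz a x := fun j => by ring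
  simp only [this, ← Finset.sum_mul, hermiteWeight, Finset.sum_add_distrib, Finset.mul_sum]
  simp

lemma harmonic_iterate_hermiteSchwartz {d : ℕ} (q : ℕ) (a : Fin d → ℕ) :
    harmonic^[q] (hermiteSchwartz a) = (hermiteWeight a : ℂ) ^ q • hermiteSchwartz a := by
  induction q with
  | zero => simp
  | succ q ih =>
    rw [Function.iterate_succ_apply', ih, harmonic_smul, harmonic_hermiteSchwartz, smul_smul,
      pow_succ]

/-! ### Orthonormality -/

lemma integral_hermiteTensor_mul {d : ℕ} (a b : Fin d → ℕ) :
    ∫ x : Rd d, hermiteTensor a x * hermiteTensor b x = if a = b then 1 else 0 := by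
  have h := integral_fintype_prod_eq_prod (μ := fun _ : Fin d => (volume : Measure ℝ))
    (fun (j : Fin d) (x : ℝ) => hermiteFun (a j) x * hermiteFun (b j) x)
  have h2 := (EuclideanSpace.volume_preserving_symm_measurableEquiv_toLp (Fin d)).integral_comp
    (MeasurableEquiv.measurableEmbedding _)
    (fun x : Fin d → ℝ => ∏ j, hermiteFun (a j) (x j) * hermiteFun (b j) (x j))
  have h3 : ∫ x : Rd d, hermiteTensor a x * hermiteTensor b x =
      ∫ x : Fin d → ℝ, ∏ j, hermiteFun (a j) (x j) * hermiteFun (b j) (x j) := by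
    rw [← h2]
    refine integral_congr_ae (Filter.Eventually.of_forall fun x => ?_)
    simp [hermiteTensor, Finset.prod_mul_distrib]
  rw [h3]
  refine h.trans ?_
  simp only [integral_hermiteFun_mul]
  by_cases hab : a = b
  · simp [hab]
  · obtain ⟨j, hj⟩ := Function.ne_iff.1 hab
    rw [if_neg hab]
    exact Finset.prod_eq_zero (Finset.mem_univ j) (if_neg hj)

/-- The class in `L²(ℝᵈ; ℂ)` of a Schwartz function. -/
def schwartzL2 {d : ℕ} (φ : 𝓢(Rd d, ℂ)) : Lp ℂ 2 (volume : Measure (Rd d)) := φ.toLp 2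

lemma coeFn_schwartzL2 {d : ℕ} (φ : 𝓢(Rd d, ℂ)) : schwartzL2 φ =ᵐ[volume] φ :=
  φ.coeFn_toLp 2

lemma inner_schwartzL2 {d : ℕ} (φ ψ : 𝓢(Rd d, ℂ)) :
    inner ℂ (schwartzL2 φ) (schwartzL2 ψ) = ∫ x, inner ℂ (φ x) (ψ x) :=
  inner_toL2_toL2_eq φ ψ

/-- `h_a` as an element of the complex Hilbert space `L²(ℝᵈ; ℂ)`. -/
def hermiteLp {d : ℕ} (a : Fin d → ℕ) : Lp ℂ 2 (volume : Measure (Rd d)) :=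
  schwartzL2 (hermiteSchwartz a)

lemma orthonormal_hermiteLp (d : ℕ) :
    Orthonormal ℂ (hermiteLp : (Fin d → ℕ) → Lp ℂ 2 (volume : Measure (Rd d))) := by
  classical
  rw [orthonormal_iff_ite]
  intro a b
  rw [hermiteLp, hermiteLp, inner_schwartzL2]
  have : ∀ x : Rd d, inner ℂ (hermiteSchwartz a x) (hermiteSchwartz b x) =
      ((hermiteTensor a x * hermiteTensor b x : ℝ) : ℂ) := fun x => by
    simp [hermiteSchwartz_apply, RCLike.inner_apply, mul_comm]
  simp only [this]
  rw [integral_complex_ofReal, integral_hermiteTensor_mul]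
  split_ifs <;> simp

/-! ### Completeness of the Hermite functions -/

/-- Locally integrable functions with equal integrals against Schwartz functions agree a.e. -/
lemma ae_eq_of_integral_schwartz {d : ℕ} {f g : Rd d → ℂ} (hf : LocallyIntegrable f)
    (hg : LocallyIntegrable g) (h : ∀ φ : 𝓢(Rd d, ℂ), ∫ x, φ x * f x = ∫ x, φ x * g x) :
    f =ᵐ[volume] g := by
  refine ae_eq_of_integral_contDiff_smul_eq hf hg fun w hw hc => ?_
  have h1 : HasCompactSupport (Complex.ofRealCLM ∘ w) := hc.comp_left rfl
  have h2 : ContDiff ℝ (⊤ : ℕ∞) (Complex.ofRealCLM ∘ w) := by fun_prop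
  have := h (h1.toSchwartzMap h2)
  simpa using this

/-- The linear span of the Hermite functions, as functions. -/
def hermiteSpan (d : ℕ) : Submodule ℂ (Rd d → ℂ) :=
  Submodule.span ℂ (Set.range fun (a : Fin d → ℕ) (x : Rd d) => (hermiteTensor a x : ℂ))

lemma mul_prod_erase_mem_hermiteSpan {d : ℕ} (a : Fin d → ℕ) (j : Fin d) {g : ℝ → ℝ}
    (hg : g ∈ Submodule.span ℝ (Set.range hermiteFun)) :
    (fun x : Rd d => ((g (x j) * ∏ i ∈ Finset.univ.erase j, hermiteFun (a i) (x i) : ℝ) : ℂ)) ∈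
      hermiteSpan d := by
  induction hg using Submodule.span_induction with
  | mem g hg =>
    obtain ⟨k, rfl⟩ := hg
    refine Submodule.subset_span ⟨Function.update a j k, funext fun x => ?_⟩
    simp only
    rw [hermiteTensor_eq_mul_prod_erase _ j, Function.update_self]
    congr 2
    refine Finset.prod_congr rfl fun i hi => ?_
    rw [Function.update_of_ne (Finset.mem_erase.1 hi).1]
  | zero =>
    convert (hermiteSpan d).zero_mem using 1
    funext x
    simp
  | add g₁ g₂ _ _ h₁ h₂ =>
    convert (hermiteSpan d).add_mem h₁ h₂ using 1
    funext x
    simp [add_mul]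
  | smul c g _ h =>
    convert (hermiteSpan d).smul_mem (c : ℂ) h using 1
    funext x
    simp [mul_assoc]

lemma coord_mul_mem_hermiteSpan {d : ℕ} (j : Fin d) {v : Rd d → ℂ} (hv : v ∈ hermiteSpan d) :
    (fun x => (x j : ℂ) * v x) ∈ hermiteSpan d := by
  induction hv using Submodule.span_induction with
  | mem v hv =>
    obtain ⟨a, rfl⟩ := hv
    convert mul_prod_erase_mem_hermiteSpan a j (mul_hermiteFun_mem_span (a j)) using 1
    funext x
    simp only [hermiteTensor_eq_mul_prod_erase a j]
    push_cast
    ring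
  | zero =>
    convert (hermiteSpan d).zero_mem using 1
    funext x
    simp
  | add g₁ g₂ _ _ h₁ h₂ =>
    convert (hermiteSpan d).add_mem h₁ h₂ using 1
    funext x
    simp [mul_add]
  | smul c g _ h =>
    convert (hermiteSpan d).smul_mem c h using 1
    funext x
    simp [mul_left_comm]

lemma inner_mul_mem_hermiteSpan {d : ℕ} (ξ : Rd d) {v : Rd d → ℂ} (hv : v ∈ hermiteSpan d) :
    (fun x => ((inner ℝ x ξ : ℝ) : ℂ) * v x) ∈ hermiteSpan d := by
  have : (fun x => ((inner ℝ x ξ : ℝ) : ℂ) * v x) =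
      ∑ j, (ξ j : ℂ) • fun x : Rd d => (x j : ℂ) * v x := by
    funext x
    simp [PiLp.inner_apply, Finset.sum_mul, mul_assoc]
  rw [this]
  exact Submodule.sum_mem _ fun j _ => Submodule.smul_mem _ _ (coord_mul_mem_hermiteSpan j hv)

lemma inner_pow_mul_mem_hermiteSpan {d : ℕ} (ξ : Rd d) (n : ℕ) :
    (fun x => ((inner ℝ x ξ : ℝ) : ℂ) ^ n * (hermiteTensor 0 x : ℂ)) ∈ hermiteSpan d := by
  induction n with
  | zero =>
    simp only [pow_zero, one_mul]
    exact Submodule.subset_span ⟨0, rfl⟩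
  | succ n ih =>
    convert inner_mul_mem_hermiteSpan ξ ih using 1
    funext x
    ring

lemma memLp_hermiteTensor_ofReal {d : ℕ} (a : Fin d → ℕ) :
    MemLp (fun x : Rd d => (hermiteTensor a x : ℂ)) 2 :=
  (memLp_hermiteTensor a).ofReal

lemma inner_hermiteLp {d : ℕ} (a : Fin d → ℕ) (f : Lp ℂ 2 (volume : Measure (Rd d))) :
    inner ℂ (hermiteLp a) f = ∫ x, (hermiteTensor a x : ℂ) * f x := by
  rw [L2.inner_def]
  refine integral_congr_ae ?_
  filter_upwards [coeFn_schwartzL2 (hermiteSchwartz a)] with x hx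
  rw [hermiteLp, hx, hermiteSchwartz_apply, RCLike.inner_apply, Complex.conj_ofReal, mul_comm]

lemma integral_mul_eq_zero_of_mem_hermiteSpan {d : ℕ} {f : Lp ℂ 2 (volume : Measure (Rd d))}
    (hf : ∀ a, inner ℂ (hermiteLp a) f = 0) {v : Rd d → ℂ} (hv : v ∈ hermiteSpan d) :
    Integrable (fun x => v x * f x) ∧ ∫ x, v x * f x = 0 := by
  induction hv using Submodule.span_induction with
  | mem v hv =>
    obtain ⟨a, rfl⟩ := hv
    exact ⟨(memLp_hermiteTensor_ofReal a).integrable_mul (Lp.memLp f),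
      by rw [← inner_hermiteLp, hf]⟩
  | zero => simp
  | add g₁ g₂ _ _ h₁ h₂ =>
    simp only [Pi.add_apply, add_mul]
    exact ⟨h₁.1.add h₂.1, by rw [integral_add h₁.1 h₂.1, h₁.2, h₂.2, add_zero]⟩
  | smul c g _ h =>
    simp only [Pi.smul_apply, smul_eq_mul, mul_assoc]
    exact ⟨h.1.const_mul c, by rw [integral_const_mul, h.2, mul_zero]⟩

lemma hermiteTensor_zero {d : ℕ} (x : Rd d) :
    hermiteTensor 0 x = (Real.sqrt (Real.sqrt Real.pi))⁻¹ ^ d * Real.exp (-‖x‖ ^ 2 / 2) := by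
  simp only [hermiteTensor, Pi.zero_apply, hermiteFun_zero, Finset.prod_mul_distrib,
    Finset.prod_const, Finset.card_univ, Fintype.card_fin, ← Real.exp_sum,
    EuclideanSpace.norm_sq_eq, Real.norm_eq_abs, sq_abs]
  rw [neg_div, Finset.sum_div, ← Finset.sum_neg_distrib]
  simp only [neg_div]

lemma hermiteTensor_zero_pos {d : ℕ} (x : Rd d) : 0 < hermiteTensor 0 x := by
  rw [hermiteTensor_zero]
  have := Real.pi_pos
  positivity

lemma continuous_hermiteTensor {d : ℕ} (a : Fin d → ℕ) : Continuous (hermiteTensor a) :=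
  continuous_finsetProd _ fun j _ => (continuous_hermiteFun (a j)).comp (by fun_prop)

/-- Half of the Gaussian exponent absorbs the exponential: `(K - |x|/2)² ≥ 0` gives `K|x| - |x|²/2 ≤
K² - |x|²/4`. The function is later one factor of a dominating function. -/
lemma memLp_exp_mul_hermiteTensor_zero {d : ℕ} (K : ℝ) :
    MemLp (fun x : Rd d => Real.exp (K * ‖x‖) * hermiteTensor 0 x) 2 := by
  have h1 : MemLp (fun x : Rd d => Real.exp (-‖x‖ ^ 2 / 4)) 2 := by
    rw [memLp_two_iff_integrable_sq (by fun_prop)]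
    refine ((gaussianSchwartz d).integrable (μ := volume)).congr
      (Filter.Eventually.of_forall fun x => ?_)
    rw [gaussianSchwartz_apply]
    simp only [← Real.exp_nat_mul]
    congr 1
    push_cast
    ring
  refine (h1.const_mul ((Real.sqrt (Real.sqrt Real.pi))⁻¹ ^ d * Real.exp (K ^ 2))).mono
    (((by fun_prop : Continuous fun x : Rd d => Real.exp (K * ‖x‖)).mul
      (continuous_hermiteTensor 0)).aestronglyMeasurable)
    (Filter.Eventually.of_forall fun x => ?_)
  rw [Real.norm_of_nonneg (mul_nonneg (Real.exp_nonneg _) (hermiteTensor_zero_pos x).le),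
    Real.norm_of_nonneg (by positivity), hermiteTensor_zero, mul_assoc, ← Real.exp_add,
    mul_left_comm, ← Real.exp_add]
  refine mul_le_mul_of_nonneg_left (Real.exp_le_exp.2 ?_) (by positivity)
  nlinarith [sq_nonneg (K - ‖x‖ / 2)]

/-- Expand the exponential in its power series. Each term is an element of the Hermite span times
`f` and integrates to zero; the partial sums are dominated by `e^{|c||ξ||x|} h_0 |f|`, a product of
two square integrable functions. -/
lemma integral_exp_mul_hermiteTensor_zero {d : ℕ} {f : Lp ℂ 2 (volume : Measure (Rd d))}
    (hf : ∀ a, inner ℂ (hermiteLp a) f = 0) (c : ℂ) (ξ : Rd d) :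
    ∫ x, Complex.exp (c * ((inner ℝ x ξ : ℝ) : ℂ)) * ((hermiteTensor 0 x : ℂ) * f x) = 0 := by
  have hmem := fun n => integral_mul_eq_zero_of_mem_hermiteSpan hf
    (inner_pow_mul_mem_hermiteSpan ξ n)
  set F : ℕ → Rd d → ℂ := fun n x => c ^ n / n.factorial *
    (((inner ℝ x ξ : ℝ) : ℂ) ^ n * (hermiteTensor 0 x : ℂ) * f x) with hF
  have hs := hasSum_integral_of_dominated_convergence (F := F) (μ := volume)
    (f := fun x => Complex.exp (c * ((inner ℝ x ξ : ℝ) : ℂ)) * ((hermiteTensor 0 x : ℂ) * f x))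
    (fun n x => (‖c‖ * ‖ξ‖ * ‖x‖) ^ n / n.factorial * (hermiteTensor 0 x * ‖f x‖))
    (fun n => ((hmem n).1.const_mul _).aestronglyMeasurable)
    (fun n => Filter.Eventually.of_forall fun x => ?_)
    (Filter.Eventually.of_forall fun x => (Real.summable_pow_div_factorial _).mul_right _) ?_
    (Filter.Eventually.of_forall fun x => ?_)
  · have h0 : ∀ n, ∫ x, F n x = 0 := fun n => by
      rw [hF]
      simp only
      rw [integral_const_mul, (hmem n).2, mul_zero]
    simp only [h0] at hs
    exact hs.unique hasSum_zero
  · have h1 : ‖inner ℝ x ξ‖ ≤ ‖x‖ * ‖ξ‖ := norm_inner_le_norm x ξ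
    simp only [hF, norm_mul, norm_div, norm_pow, Complex.norm_natCast, Complex.norm_real,
      Real.norm_of_nonneg (hermiteTensor_zero_pos x).le]
    have h2 : 0 ≤ hermiteTensor 0 x := (hermiteTensor_zero_pos x).le
    calc ‖c‖ ^ n / n.factorial * (‖inner ℝ x ξ‖ ^ n * hermiteTensor 0 x * ‖f x‖)
        ≤ ‖c‖ ^ n / n.factorial * ((‖x‖ * ‖ξ‖) ^ n * hermiteTensor 0 x * ‖f x‖) := by gcongr
      _ = _ := by ring
  · have h1 := (memLp_exp_mul_hermiteTensor_zero (d := d) (‖c‖ * ‖ξ‖)).integrable_mul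
      (Lp.memLp f).norm
    refine h1.congr (Filter.Eventually.of_forall fun x => ?_)
    simp only [Pi.mul_apply]
    rw [tsum_mul_right, Real.exp_eq_exp_ℝ, NormedSpace.exp_eq_tsum_div, mul_assoc]
  · have h1 := NormedSpace.expSeries_div_hasSum_exp (c * ((inner ℝ x ξ : ℝ) : ℂ))
    rw [← Complex.exp_eq_exp_ℂ] at h1
    refine (h1.mul_right ((hermiteTensor 0 x : ℂ) * f x)).congr_fun fun n => ?_
    simp only [hF]
    ring

/-- A square integrable function orthogonal to all Hermite functions vanishes. -/
lemma eq_zero_of_inner_hermiteLp_eq_zero {d : ℕ} {f : Lp ℂ 2 (volume : Measure (Rd d))}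
    (hf : ∀ a, inner ℂ (hermiteLp a) f = 0) : f = 0 := by
  have hG : Integrable fun x => (hermiteTensor 0 x : ℂ) * f x :=
    (memLp_hermiteTensor_ofReal 0).integrable_mul (Lp.memLp f)
  -- The case `c = -2πi` of the vanishing integrals. As `h_0` has no zeros, injectivity of the
  -- Fourier transform on integrable functions will give `f = 0`.
  have hFG : 𝓕 (fun x => (hermiteTensor 0 x : ℂ) * f x) = 0 := by
    funext ξ
    rw [Real.fourier_eq', Pi.zero_apply, ← integral_exp_mul_hermiteTensor_zero hf (-2 * Real.pi * Complex.I) ξ]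
    refine integral_congr_ae (Filter.Eventually.of_forall fun x => ?_)
    simp only [smul_eq_mul]
    congr 2
    push_cast
    ring
  have h0 : (fun x => (hermiteTensor 0 x : ℂ) * f x) =ᵐ[volume] fun _ => 0 := by
    refine ae_eq_of_integral_schwartz hG.locallyIntegrable (locallyIntegrable_const 0) fun φ => ?_
    -- Injectivity by duality: write the test function as `φ = 𝓕 (𝓕⁻ φ)` and move the outer
    -- transform onto `h_0 f`.
    have h1 := VectorFourier.integral_fourierIntegral_smul_eq_flip (L := innerₗ (Rd d))
      (μ := volume) (ν := volume) Real.continuous_fourierChar continuous_inner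
      (f := (𝓕⁻ φ : 𝓢(Rd d, ℂ))) (g := fun x => (hermiteTensor 0 x : ℂ) * f x) (𝓕⁻ φ : 𝓢(Rd d, ℂ)).integrable hG
    have h2 : VectorFourier.fourierIntegral Real.fourierChar volume (innerₗ (Rd d))
        (𝓕⁻ φ : 𝓢(Rd d, ℂ)) = φ := by
      have : ((𝓕 (𝓕⁻ φ) : 𝓢(Rd d, ℂ)) : Rd d → ℂ) = φ := by simp
      rw [fourier_coe] at this
      exact this
    have h3 : VectorFourier.fourierIntegral Real.fourierChar volume (innerₗ (Rd d)).flip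
        (fun x => (hermiteTensor 0 x : ℂ) * f x) = 0 := by
      rw [flip_innerₗ]
      exact hFG
    rw [h2, h3] at h1
    simpa using h1
  rw [Lp.eq_zero_iff_ae_eq_zero]
  filter_upwards [h0] with x hx
  have := (hermiteTensor_zero_pos x).ne'
  simpa [this] using hx

/-- The Hermite functions form a Hilbert basis of `L²(ℝᵈ; ℂ)`. -/
def hermiteBasis (d : ℕ) : HilbertBasis (Fin d → ℕ) ℂ (Lp ℂ 2 (volume : Measure (Rd d))) :=
  HilbertBasis.mkOfOrthogonalEqBot (orthonormal_hermiteLp d) (by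
    rw [Submodule.eq_bot_iff]
    intro f hf
    refine eq_zero_of_inner_hermiteLp_eq_zero fun a => ?_
    exact (Submodule.mem_orthogonal _ _).1 hf _ (Submodule.subset_span ⟨a, rfl⟩))

lemma hermiteBasis_apply {d : ℕ} (a : Fin d → ℕ) : hermiteBasis d a = hermiteLp a := by
  simp [hermiteBasis]

/-! ### The inverse Fourier transform on Schwartz functions -/

lemma fourierInvSchwartz_eq {d : ℕ} (φ : 𝓢(Rd d, ℂ)) (x : Rd d) :
    fourierInvSchwartz d φ x = (((2 * Real.pi) ^ d : ℝ) : ℂ)⁻¹ *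
      (𝓕⁻ φ : 𝓢(Rd d, ℂ)) ((2 * Real.pi)⁻¹ • x) := rfl

lemma scaleInvTwoPi_apply {d : ℕ} (x : Rd d) : scaleInvTwoPi d x = (2 * Real.pi)⁻¹ • x := rfl

lemma fourierInvSchwartz_eq_smul {d : ℕ} (φ : 𝓢(Rd d, ℂ)) :
    fourierInvSchwartz d φ = (((2 * Real.pi) ^ d : ℝ) : ℂ)⁻¹ •
      compCLMOfContinuousLinearEquiv ℂ (scaleInvTwoPi d) (𝓕⁻ φ : 𝓢(Rd d, ℂ)) := rfl

/-- The chain-rule factor `(2π)⁻¹` of the rescaling cancels the `2π` that differentiating `𝓕⁻`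
produces, leaving a bare `i`. -/
lemma lineDeriv_fourierInvSchwartz {d : ℕ} (j : Fin d) (φ : 𝓢(Rd d, ℂ)) :
    ∂_{stdVec j} (fourierInvSchwartz d φ) =
      Complex.I • fourierInvSchwartz d (coordMul j φ) := by
  have hpi : (Real.pi : ℂ) ≠ 0 := by exact_mod_cast Real.pi_ne_zero
  rw [fourierInvSchwartz_eq_smul, LineDeriv.lineDerivOp_smul,
    lineDerivOp_compCLMOfContinuousLinearEquiv, scaleInvTwoPi_apply,
    LineDeriv.lineDerivOp_left_smul, lineDerivOp_fourierInv_eq, fourierInvSchwartz_eq_smul,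
    FourierTransform.fourierInv_smul]
  ext x
  simp only [smul_apply, compCLMOfContinuousLinearEquiv_apply, Function.comp_apply,
    smul_eq_mul, Complex.real_smul, coordMul]
  push_cast
  field_simp

lemma fourierInvSchwartz_lineDeriv {d : ℕ} (j : Fin d) (φ : 𝓢(Rd d, ℂ)) :
    fourierInvSchwartz d (∂_{stdVec j} φ) =
      (-Complex.I) • coordMul j (fourierInvSchwartz d φ) := by
  have hpi : (Real.pi : ℂ) ≠ 0 := by exact_mod_cast Real.pi_ne_zero
  have hg : (fun x : Rd d => (inner ℝ x (stdVec j) : ℝ)).HasTemperateGrowth := by fun_prop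
  ext x
  rw [fourierInvSchwartz_eq, fourierInv_lineDerivOp_eq, smul_apply, smul_apply,
    smulLeftCLM_apply_apply hg, coordMul_apply, fourierInvSchwartz_eq, real_inner_smul_left,
    inner_stdVec]
  simp only [smul_eq_mul, Complex.real_smul]
  push_cast
  field_simp

lemma coordMul_smul {d : ℕ} (j : Fin d) (c : ℂ) (φ : 𝓢(Rd d, ℂ)) :
    coordMul j (c • φ) = c • coordMul j φ := by
  ext x
  simp only [coordMul_apply, smul_apply, smul_eq_mul]
  ring

/-- The two halves of the oscillator are exchanged: `x_j²` becomes `-∂_j²` and `-∂_j²` becomes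
`x_j²`, both signs coming from `i² = -1`. -/
lemma fourierInvSchwartz_harmonic {d : ℕ} (φ : 𝓢(Rd d, ℂ)) :
    fourierInvSchwartz d (harmonic φ) = harmonic (fourierInvSchwartz d φ) := by
  rw [harmonic, harmonic, map_sum]
  refine Finset.sum_congr rfl fun j _ => ?_
  rw [map_sub, fourierInvSchwartz_lineDeriv, fourierInvSchwartz_lineDeriv, coordMul_smul,
    smul_smul, lineDeriv_fourierInvSchwartz, LineDeriv.lineDerivOp_smul,
    lineDeriv_fourierInvSchwartz, smul_smul, neg_mul_neg, Complex.I_mul_I, neg_one_smul,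
    neg_one_smul]
  abel

lemma fourierInvSchwartz_harmonic_iterate {d : ℕ} (q : ℕ) (φ : 𝓢(Rd d, ℂ)) :
    fourierInvSchwartz d (harmonic^[q] φ) = harmonic^[q] (fourierInvSchwartz d φ) := by
  induction q generalizing φ with
  | zero => rfl
  | succ q ih =>
    rw [Function.iterate_succ_apply, Function.iterate_succ_apply, ih,
      fourierInvSchwartz_harmonic]

lemma fourierInvSchwartz_surjective (d : ℕ) : Function.Surjective (fourierInvSchwartz d) := by
  intro ψ
  refine ⟨𝓕 ((((2 * Real.pi) ^ d : ℝ) : ℂ) •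
    compCLMOfContinuousLinearEquiv ℂ (scaleInvTwoPi d).symm ψ), ?_⟩
  ext x
  rw [fourierInvSchwartz_eq_smul, FourierTransform.fourierInv_fourier_eq]
  simp

/-- Parseval's identity. -/
lemma inner_schwartzL2_fourierInvSchwartz {d : ℕ} (φ ψ : 𝓢(Rd d, ℂ)) :
    inner ℂ (schwartzL2 (fourierInvSchwartz d φ)) (schwartzL2 (fourierInvSchwartz d ψ)) =
      (((2 * Real.pi) ^ d : ℝ) : ℂ)⁻¹ *
        inner ℂ (schwartzL2 φ) (schwartzL2 ψ) := by
  rw [inner_schwartzL2, inner_schwartzL2]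
  have h1 := integral_inner_fourier_fourier (𝓕⁻ φ : 𝓢(Rd d, ℂ)) (𝓕⁻ ψ : 𝓢(Rd d, ℂ))
  simp only [FourierTransform.fourier_fourierInv_eq] at h1
  rw [h1]
  have h2 := Measure.integral_comp_smul (volume : Measure (Rd d))
    (fun x => inner ℂ ((𝓕⁻ φ : 𝓢(Rd d, ℂ)) x) ((𝓕⁻ ψ : 𝓢(Rd d, ℂ)) x)) (2 * Real.pi)⁻¹
  have hpi := Real.pi_pos
  rw [finrank_euclideanSpace_fin, inv_pow, inv_inv, abs_of_pos (by positivity)] at h2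
  have h3 : ∀ x, inner ℂ (fourierInvSchwartz d φ x) (fourierInvSchwartz d ψ x) =
      (((2 * Real.pi) ^ d : ℝ) : ℂ)⁻¹ ^ 2 * inner ℂ ((𝓕⁻ φ : 𝓢(Rd d, ℂ)) ((2 * Real.pi)⁻¹ • x))
        ((𝓕⁻ ψ : 𝓢(Rd d, ℂ)) ((2 * Real.pi)⁻¹ • x)) := fun x => by
    rw [fourierInvSchwartz_eq, fourierInvSchwartz_eq, RCLike.inner_apply, RCLike.inner_apply,
      map_mul, ← Complex.ofReal_inv, Complex.conj_ofReal]
    ring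
  simp only [h3]
  rw [integral_const_mul, h2, Complex.real_smul, ← mul_assoc]
  congr 1
  have hc : (((2 * Real.pi) ^ d : ℝ) : ℂ) ≠ 0 := by
    exact_mod_cast (by positivity : (2 * Real.pi) ^ d ≠ 0)
  field_simp

lemma norm_schwartzL2_fourierInvSchwartz_sq {d : ℕ} (φ : 𝓢(Rd d, ℂ)) :
    ‖schwartzL2 (fourierInvSchwartz d φ)‖ ^ 2 =
      ((2 * Real.pi) ^ d)⁻¹ * ‖schwartzL2 φ‖ ^ 2 := by
  have h := inner_schwartzL2_fourierInvSchwartz φ φ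
  rw [inner_self_eq_norm_sq_to_K, inner_self_eq_norm_sq_to_K] at h
  apply Complex.ofReal_injective
  rw [Complex.ofReal_mul, Complex.ofReal_inv, Complex.ofReal_pow, Complex.ofReal_pow _ 2]
  exact h

/-- The `ℱ⁻¹ h_a`, suitably normalized, are orthonormal. -/
lemma orthonormal_fourierInvSchwartz_hermite (d : ℕ) :
    Orthonormal ℂ fun a : Fin d → ℕ => ((Real.sqrt ((2 * Real.pi) ^ d) : ℝ) : ℂ) •
      schwartzL2 (fourierInvSchwartz d (hermiteSchwartz a)) := by
  classical
  rw [orthonormal_iff_ite]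
  intro a b
  have h0 := orthonormal_iff_ite.1 (orthonormal_hermiteLp d) a b
  have hpi := Real.pi_pos
  have h1 : ((Real.sqrt ((2 * Real.pi) ^ d) : ℝ) : ℂ) * ((Real.sqrt ((2 * Real.pi) ^ d) : ℝ) : ℂ) =
      (((2 * Real.pi) ^ d : ℝ) : ℂ) := by
    rw [← Complex.ofReal_mul, Real.mul_self_sqrt (by positivity)]
  have hc : (((2 * Real.pi) ^ d : ℝ) : ℂ) ≠ 0 := by
    exact_mod_cast (by positivity : (2 * Real.pi) ^ d ≠ 0)
  rw [inner_smul_left, inner_smul_right, Complex.conj_ofReal, ← mul_assoc, h1,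
    inner_schwartzL2_fourierInvSchwartz, ← mul_assoc, mul_inv_cancel₀ hc, one_mul]
  exact h0

/-! ### The translates of the Matérn kernel as distributions -/

/-- The Fourier transform `ξ ↦ e^{-i⟨ξ, y⟩} (|ξ|² + m²)^{-α}` of the translate by `y` of the Matérn
kernel. -/
def translateSymbol (d : ℕ) (α m : ℝ) (y ξ : Rd d) : ℂ :=
  Complex.exp (-Complex.I * ((inner ℝ ξ y : ℝ) : ℂ)) * maternSymbol d α m ξ

/-- Reflection and translation together replace `φ` by `x ↦ φ (y - x)`, whose inverse transform at
`-ξ` is that of `φ` at `ξ` times a phase; the Matérn symbol is even, so the substitution `ξ ↦ -ξ`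
costs nothing. Everything below works with this integral on the Fourier side. -/
lemma translate_reflect_maternKernel_apply {d : ℕ} (α m : ℝ) (hm : 0 < m) (y : Rd d)
    (φ : 𝓢(Rd d, ℂ)) :
    translate y (reflect (maternKernel d α m hm)) φ =
      ∫ ξ, translateSymbol d α m y ξ * fourierInvSchwartz d φ ξ := by
  set ψ : 𝓢(Rd d, ℂ) := compCLMOfContinuousLinearEquiv ℂ
    (ContinuousLinearEquiv.neg ℝ : Rd d ≃L[ℝ] Rd d) (compSubConstCLM ℂ (-y) φ) with hψ
  have h0 : translate y (reflect (maternKernel d α m hm)) φ =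
      ∫ ξ, fourierInvSchwartz d ψ ξ • maternSymbol d α m ξ := rfl
  have hψx : ∀ x, ψ x = φ (y - x) := fun x => by
    simp [hψ, neg_add_eq_sub]
  have h1 : ∀ ξ, fourierInvSchwartz d ψ (-ξ) =
      Complex.exp (-Complex.I * ((inner ℝ ξ y : ℝ) : ℂ)) * fourierInvSchwartz d φ ξ := by
    intro ξ
    rw [fourierInvSchwartz_apply, fourierInvSchwartz_apply, mul_left_comm]
    congr 1
    rw [← integral_const_mul, ← integral_sub_left_eq_self _ volume y]
    refine integral_congr_ae (Filter.Eventually.of_forall fun x => ?_)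
    simp only [hψx, sub_sub_cancel]
    rw [← mul_assoc, ← Complex.exp_add]
    congr 2
    rw [inner_neg_right, inner_sub_left, real_inner_comm y ξ]
    push_cast
    ring
  rw [h0, ← integral_neg_eq_self]
  refine integral_congr_ae (Filter.Eventually.of_forall fun ξ => ?_)
  simp only [h1, translateSymbol, smul_eq_mul, maternSymbol, norm_neg]
  ring

/-! ### Functions of moderate growth and integration by parts -/

/-- Continuous functions bounded by a multiple of `(|ξ|² + m²)^{s/2}`. -/
def ModerateGrowth {d : ℕ} (m s : ℝ) (u : Rd d → ℂ) : Prop :=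
  Continuous u ∧ ∃ C : ℝ, ∀ ξ, ‖u ξ‖ ≤ C * (‖ξ‖ ^ 2 + m ^ 2) ^ (s / 2)

lemma norm_sq_add_pos {d : ℕ} {m : ℝ} (hm : 0 < m) (ξ : Rd d) : 0 < ‖ξ‖ ^ 2 + m ^ 2 := by
  positivity

lemma abs_coord_le_rpow {d : ℕ} (m : ℝ) (j : Fin d) (ξ : Rd d) :
    ‖(ξ j : ℂ)‖ ≤ (‖ξ‖ ^ 2 + m ^ 2) ^ (1 / 2 : ℝ) := by
  rw [← Real.sqrt_eq_rpow, Complex.norm_real]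
  refine (PiLp.norm_apply_le ξ j).trans (Real.le_sqrt_of_sq_le ?_)
  nlinarith [sq_nonneg m]

lemma rpow_half_add {d : ℕ} {m : ℝ} (hm : 0 < m) (s t : ℝ) (ξ : Rd d) :
    (‖ξ‖ ^ 2 + m ^ 2) ^ ((s + t) / 2) =
      (‖ξ‖ ^ 2 + m ^ 2) ^ (s / 2) * (‖ξ‖ ^ 2 + m ^ 2) ^ (t / 2) := by
  rw [add_div, Real.rpow_add (norm_sq_add_pos hm ξ)]

/-- The base is bounded below by `m²`, so its power with the nonpositive exponent `(s - t)/2` is at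
most that of `m²`. -/
lemma rpow_half_mono {d : ℕ} {m : ℝ} (hm : 0 < m) {s t : ℝ} (hst : s ≤ t) (ξ : Rd d) :
    (‖ξ‖ ^ 2 + m ^ 2) ^ (s / 2) ≤
      (m ^ 2) ^ ((s - t) / 2) * (‖ξ‖ ^ 2 + m ^ 2) ^ (t / 2) := by
  have : s = (s - t) + t := by ring
  conv_lhs => rw [this, rpow_half_add hm]
  refine mul_le_mul_of_nonneg_right ?_ (Real.rpow_nonneg (norm_sq_add_pos hm ξ).le _)
  exact Real.rpow_le_rpow_of_nonpos (by positivity) (by nlinarith [sq_nonneg ‖ξ‖]) (by linarith)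

namespace ModerateGrowth

variable {d : ℕ} {m s t : ℝ} {u v : Rd d → ℂ}

lemma mono (hm : 0 < m) (hst : s ≤ t) (hu : ModerateGrowth m s u) : ModerateGrowth m t u := by
  obtain ⟨hc, C, hC⟩ := hu
  refine ⟨hc, |C| * (m ^ 2) ^ ((s - t) / 2), fun ξ => (hC ξ).trans ?_⟩
  rw [mul_assoc]
  have h1 := rpow_half_mono hm hst ξ
  have h2 : 0 ≤ (‖ξ‖ ^ 2 + m ^ 2) ^ (s / 2) := Real.rpow_nonneg (norm_sq_add_pos hm ξ).le _
  calc C * (‖ξ‖ ^ 2 + m ^ 2) ^ (s / 2) ≤ |C| * (‖ξ‖ ^ 2 + m ^ 2) ^ (s / 2) := by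
        gcongr
        exact le_abs_self C
    _ ≤ _ := by gcongr

lemma coord (hm : 0 < m) (hu : ModerateGrowth m s u) (j : Fin d) :
    ModerateGrowth m (s + 1) fun ξ => (ξ j : ℂ) * u ξ := by
  obtain ⟨hc, C, hC⟩ := hu
  refine ⟨by fun_prop, C, fun ξ => ?_⟩
  have h0 : 0 ≤ (‖ξ‖ ^ 2 + m ^ 2) ^ (1 / 2 : ℝ) := Real.rpow_nonneg (norm_sq_add_pos hm ξ).le _
  rw [norm_mul, rpow_half_add hm]
  calc ‖(ξ j : ℂ)‖ * ‖u ξ‖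
      ≤ (‖ξ‖ ^ 2 + m ^ 2) ^ (1 / 2 : ℝ) * (C * (‖ξ‖ ^ 2 + m ^ 2) ^ (s / 2)) :=
        mul_le_mul (abs_coord_le_rpow m j ξ) (hC ξ) (norm_nonneg _) h0
    _ = _ := by ring

/-- The growth bound is itself a Matérn symbol, with exponent `-(s/2)`; it has temperate growth, so
its product with `φ` is Schwartz and dominates. -/
lemma integrable_mul (hm : 0 < m) (hu : ModerateGrowth m s u) (φ : 𝓢(Rd d, ℂ)) :
    Integrable fun ξ => u ξ * φ ξ := by
  obtain ⟨hc, C, hC⟩ := hu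
  have hg := maternSymbol_hasTemperateGrowth d (-(s / 2)) hm
  have hi := ((smulLeftCLM ℂ (maternSymbol d (-(s / 2)) m) φ).integrable (μ := volume)).norm
  refine (hi.const_mul C).mono' (hc.mul φ.continuous).aestronglyMeasurable
    (Filter.Eventually.of_forall fun ξ => ?_)
  have hp := norm_sq_add_pos hm ξ
  rw [smulLeftCLM_apply_apply hg, norm_smul, norm_mul, maternSymbol, Complex.norm_real,
    Real.norm_of_nonneg (by positivity), Real.rpow_neg hp.le, one_div, inv_inv, ← mul_assoc]
  exact mul_le_mul_of_nonneg_right (hC ξ) (norm_nonneg _)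

/-- Integration by parts against a Schwartz function. -/
lemma integral_mul_lineDeriv (hm : 0 < m) (hu : ModerateGrowth m s u)
    (hv : ModerateGrowth m t v) (j : Fin d)
    (h : ∀ ξ, HasLineDerivAt ℝ u (v ξ) ξ (stdVec j)) (φ : 𝓢(Rd d, ℂ)) :
    ∫ ξ, u ξ * ∂_{stdVec j} φ ξ = -∫ ξ, v ξ * φ ξ :=
  integral_bilinear_hasLineDerivAt_right_eq_neg_left_of_integrable
    (B := ContinuousLinearMap.mul ℝ ℂ) (hv.integrable_mul hm φ)
    (hu.integrable_mul hm (∂_{stdVec j} φ)) (hu.integrable_mul hm φ)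
    (fun ξ _ => h ξ) fun ξ _ => by
      rw [lineDerivOp_apply]
      exact φ.differentiableAt.lineDifferentiableAt.hasLineDerivAt

lemma integral_mul_harmonic (hm : 0 < m) (hu : ModerateGrowth m s u)
    {u' u'' : Fin d → Rd d → ℂ} (hu' : ∀ j, ModerateGrowth m s (u' j))
    (hu'' : ∀ j, ModerateGrowth m s (u'' j))
    (h' : ∀ j ξ, HasLineDerivAt ℝ u (u' j ξ) ξ (stdVec j))
    (h'' : ∀ j ξ, HasLineDerivAt ℝ (u' j) (u'' j ξ) ξ (stdVec j)) (φ : 𝓢(Rd d, ℂ)) :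
    ∫ ξ, u ξ * harmonic φ ξ =
      ∫ ξ, (∑ j, ((ξ j : ℂ) * ((ξ j : ℂ) * u ξ) - u'' j ξ)) * φ ξ := by
  have hi1 : ∀ j, Integrable fun ξ => (ξ j : ℂ) * ((ξ j : ℂ) * u ξ) * φ ξ := fun j =>
    ((hu.coord hm j).coord hm j).integrable_mul hm φ
  have hi2 : ∀ j, Integrable fun ξ => u'' j ξ * φ ξ := fun j => (hu'' j).integrable_mul hm φ
  have hi3 : ∀ j : Fin d, Integrable fun ξ => u ξ * (∂_{stdVec j} (∂_{stdVec j} φ) : 𝓢(Rd d, ℂ)) ξ := fun j =>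
    hu.integrable_mul hm (∂_{stdVec j} (∂_{stdVec j} φ))
  have hIBP : ∀ j : Fin d, ∫ ξ, u ξ * (∂_{stdVec j} (∂_{stdVec j} φ) : 𝓢(Rd d, ℂ)) ξ = ∫ ξ, u'' j ξ * φ ξ := fun j => by
    rw [hu.integral_mul_lineDeriv hm (hu' j) j (h' j),
      (hu' j).integral_mul_lineDeriv hm (hu'' j) j (h'' j), neg_neg]
  calc ∫ ξ, u ξ * harmonic φ ξ
      = ∫ ξ, ∑ j, ((ξ j : ℂ) * ((ξ j : ℂ) * u ξ) * φ ξ -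
          u ξ * (∂_{stdVec j} (∂_{stdVec j} φ) : 𝓢(Rd d, ℂ)) ξ) := by
        refine integral_congr_ae (Filter.Eventually.of_forall fun ξ => ?_)
        simp only [harmonic_apply, Finset.mul_sum]
        exact Finset.sum_congr rfl fun j _ => by ring
    _ = ∑ j, ((∫ ξ, (ξ j : ℂ) * ((ξ j : ℂ) * u ξ) * φ ξ) - ∫ ξ, u'' j ξ * φ ξ) := by
        refine (integral_finsetSum _ fun j _ => (hi1 j).sub (hi3 j)).trans ?_
        exact Finset.sum_congr rfl fun j _ => by
          rw [← hIBP]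
          exact integral_sub (hi1 j) (hi3 j)
    _ = _ := by
        simp only [Finset.sum_mul, sub_mul]
        refine Eq.trans ?_ (integral_finsetSum _ fun j _ => (hi1 j).sub (hi2 j)).symm
        exact Finset.sum_congr rfl fun j _ => (integral_sub (hi1 j) (hi2 j)).symm

end ModerateGrowth

/-! ### Symbols -/

/-- The symbols of order `s` generated by the powers of `|ξ|² + m²` and the coordinates. -/
inductive IsSymbol {d : ℕ} (m : ℝ) : ℝ → (Rd d → ℂ) → Prop
  | base (β : ℝ) : IsSymbol m (-2 * β) fun ξ => (((‖ξ‖ ^ 2 + m ^ 2) ^ (-β) : ℝ) : ℂ)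
  | coord (j : Fin d) {s : ℝ} {a : Rd d → ℂ} (ha : IsSymbol m s a) :
      IsSymbol m (s + 1) fun ξ => (ξ j : ℂ) * a ξ
  | add {s : ℝ} {a b : Rd d → ℂ} (ha : IsSymbol m s a) (hb : IsSymbol m s b) :
      IsSymbol m s fun ξ => a ξ + b ξ
  | smul (c : ℂ) {s : ℝ} {a : Rd d → ℂ} (ha : IsSymbol m s a) : IsSymbol m s fun ξ => c * a ξ
  | mono {s t : ℝ} {a : Rd d → ℂ} (hst : s ≤ t) (ha : IsSymbol m s a) : IsSymbol m t a

lemma hasLineDerivAt_coord {d : ℕ} (j k : Fin d) (ξ : Rd d) :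
    HasLineDerivAt ℝ (fun ξ : Rd d => (ξ k : ℂ)) (if k = j then 1 else 0) ξ (stdVec j) := by
  unfold HasLineDerivAt
  have h : HasDerivAt (fun t : ℝ => ξ k + t * (if k = j then 1 else 0))
      (if k = j then 1 else 0) 0 := by
    simpa using ((hasDerivAt_id (0 : ℝ)).mul_const (if k = j then (1 : ℝ) else 0)).const_add (ξ k)
  have h2 := h.ofReal_comp
  refine (h2.congr_deriv (by split_ifs <;> simp)).congr_of_eventuallyEq
    (Filter.Eventually.of_forall fun t => ?_)
  simp [stdVec]

lemma hasLineDerivAt_mul {d : ℕ} {a b : Rd d → ℂ} {a' b' : ℂ} {ξ v : Rd d}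
    (ha : HasLineDerivAt ℝ a a' ξ v) (hb : HasLineDerivAt ℝ b b' ξ v) :
    HasLineDerivAt ℝ (fun ξ => a ξ * b ξ) (a' * b ξ + a ξ * b') ξ v := by
  unfold HasLineDerivAt at *
  exact (HasDerivAt.mul ha hb).congr_deriv (by simp)

lemma hasLineDerivAt_base {d : ℕ} {m : ℝ} (hm : 0 < m) (β : ℝ) (j : Fin d) (ξ : Rd d) :
    HasLineDerivAt ℝ (fun ξ : Rd d => (((‖ξ‖ ^ 2 + m ^ 2) ^ (-β) : ℝ) : ℂ))
      ((-2 * β : ℂ) * ((ξ j : ℂ) * (((‖ξ‖ ^ 2 + m ^ 2) ^ (-(β + 1)) : ℝ) : ℂ))) ξ (stdVec j) := by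
  unfold HasLineDerivAt
  have h0 : ∀ t : ℝ, ‖ξ + t • stdVec j‖ ^ 2 + m ^ 2 = ‖ξ‖ ^ 2 + 2 * ξ j * t + t ^ 2 + m ^ 2 := by
    intro t
    rw [norm_add_sq_real, norm_smul, real_inner_smul_right, inner_stdVec]
    simp
    ring
  have h1 : HasDerivAt (fun t : ℝ => ‖ξ‖ ^ 2 + 2 * ξ j * t + t ^ 2 + m ^ 2) (2 * ξ j) 0 := by
    have := ((((hasDerivAt_id (0 : ℝ)).const_mul (2 * ξ j)).const_add (‖ξ‖ ^ 2)).add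
      (hasDerivAt_pow 2 (0 : ℝ))).add_const (m ^ 2)
    exact this.congr_deriv (by simp)
  have h2 := (h1.rpow_const (p := -β) (Or.inl (by
    have := norm_sq_add_pos hm ξ
    simpa using this.ne'))).ofReal_comp
  simp only [h0]
  refine h2.congr_deriv ?_
  have e : -β - 1 = -(β + 1) := by ring
  simp only [mul_zero, add_zero, e, ne_eq, OfNat.ofNat_ne_zero, not_false_eq_true, zero_pow]
  push_cast
  ring

namespace IsSymbol

variable {d : ℕ} {m s t : ℝ} {a b : Rd d → ℂ}

lemma zero (s : ℝ) : IsSymbol (d := d) m s fun _ => 0 := by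
  have h := IsSymbol.smul 0 (IsSymbol.base (d := d) (m := m) (-s / 2))
  rw [show -2 * (-s / 2) = s by ring] at h
  simpa using h

lemma neg (ha : IsSymbol m s a) : IsSymbol m s fun ξ => -a ξ := by
  simpa using ha.smul (-1)

lemma sum {ι : Type*} (I : Finset ι) {f : ι → Rd d → ℂ} (hf : ∀ i, IsSymbol m s (f i)) :
    IsSymbol m s fun ξ => ∑ i ∈ I, f i ξ := by
  classical
  induction I using Finset.induction_on with
  | empty => simpa using IsSymbol.zero s
  | insert i I hi ih =>
    simp only [Finset.sum_insert hi]
    exact (hf i).add ih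

/-- Symbols are closed under coordinates and constants, so the factor is expanded as `∑ ξ_j² + m²`.
-/
lemma norm_sq_add_mul (ha : IsSymbol m s a) :
    IsSymbol m (s + 2) fun ξ => ((‖ξ‖ ^ 2 + m ^ 2 : ℝ) : ℂ) * a ξ := by
  have h1 : IsSymbol m (s + 2) fun ξ : Rd d => ∑ j, (ξ j : ℂ) * ((ξ j : ℂ) * a ξ) :=
    IsSymbol.sum _ fun j => by
      have := (ha.coord j).coord j
      rwa [show s + 1 + 1 = s + 2 by ring] at this
  have h2 := h1.add ((ha.mono (by linarith : s ≤ s + 2)).smul ((m ^ 2 : ℝ) : ℂ))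
  convert h2 using 2 with ξ
  rw [EuclideanSpace.norm_sq_eq]
  push_cast
  simp only [add_mul, Finset.sum_mul, Real.norm_eq_abs, ← mul_assoc, ← sq]
  congr 1
  refine Finset.sum_congr rfl fun j _ => ?_
  rw [← Complex.ofReal_pow, sq_abs, Complex.ofReal_pow]

lemma moderateGrowth (hm : 0 < m) (ha : IsSymbol m s a) : ModerateGrowth m s a := by
  induction ha with
  | base β =>
    refine ⟨?_, 1, fun ξ => ?_⟩
    · refine Complex.continuous_ofReal.comp (Continuous.rpow_const (by fun_prop) fun ξ => Or.inl ?_)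
      exact (norm_sq_add_pos hm ξ).ne'
    · rw [Complex.norm_real, Real.norm_of_nonneg (Real.rpow_nonneg (norm_sq_add_pos hm ξ).le _),
        one_mul, show -2 * β / 2 = -β by ring]
  | coord j _ ih => exact ih.coord hm j
  | add _ _ iha ihb =>
    obtain ⟨hc, C, hC⟩ := iha
    obtain ⟨hc', C', hC'⟩ := ihb
    refine ⟨hc.add hc', C + C', fun ξ => (norm_add_le _ _).trans ?_⟩
    rw [add_mul]
    exact add_le_add (hC ξ) (hC' ξ)
  | smul c _ ih =>
    obtain ⟨hc, C, hC⟩ := ih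
    refine ⟨by fun_prop, ‖c‖ * C, fun ξ => ?_⟩
    rw [norm_mul, mul_assoc]
    exact mul_le_mul_of_nonneg_left (hC ξ) (norm_nonneg _)
  | mono hst _ ih => exact ih.mono hm hst

/-- Differentiation lowers the order by one. In the base case the power drops by one (two orders)
and a factor `ξ_j` appears (one order). -/
lemma exists_hasLineDerivAt (hm : 0 < m) (ha : IsSymbol m s a) (j : Fin d) :
    ∃ a', IsSymbol m (s - 1) a' ∧ ∀ ξ, HasLineDerivAt ℝ a (a' ξ) ξ (stdVec j) := by
  induction ha with
  | base β =>
    refine ⟨_, ?_, hasLineDerivAt_base hm β j⟩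
    have := ((IsSymbol.base (m := m) (β + 1)).coord j).smul (-2 * β : ℂ)
    rwa [show -2 * (β + 1) + 1 = -2 * β - 1 by ring] at this
  | @coord k s a ha ih =>
    obtain ⟨a', ha', h'⟩ := ih
    refine ⟨_, ?_, fun ξ => hasLineDerivAt_mul (hasLineDerivAt_coord j k ξ) (h' ξ)⟩
    refine IsSymbol.add ?_ ?_
    · rw [add_sub_cancel_right]
      exact ha.smul _
    · have := ha'.coord k
      rwa [show s - 1 + 1 = s + 1 - 1 by ring] at this
  | add _ _ iha ihb =>
    obtain ⟨a', ha', h'⟩ := iha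
    obtain ⟨b', hb', h''⟩ := ihb
    exact ⟨_, ha'.add hb', fun ξ => HasDerivAt.add (h' ξ) (h'' ξ)⟩
  | smul c _ ih =>
    obtain ⟨a', ha', h'⟩ := ih
    exact ⟨_, ha'.smul c, fun ξ => HasDerivAt.const_mul c (h' ξ)⟩
  | mono hst _ ih =>
    obtain ⟨a', ha', h'⟩ := ih
    exact ⟨a', ha'.mono (by linarith), h'⟩

/-- To leading order, the harmonic oscillator acts on symbols as multiplication by `|ξ|² + m²`. -/
lemma exists_integral_mul_harmonic (hm : 0 < m) (ha : IsSymbol m s a) :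
    ∃ r, IsSymbol m s r ∧ ∀ φ : 𝓢(Rd d, ℂ), ∫ ξ, a ξ * harmonic φ ξ =
      ∫ ξ, (((‖ξ‖ ^ 2 + m ^ 2 : ℝ) : ℂ) * a ξ + r ξ) * φ ξ := by
  choose a' ha' h' using fun j => ha.exists_hasLineDerivAt hm j
  choose a'' ha'' h'' using fun j => (ha' j).exists_hasLineDerivAt hm j
  have ha1 : ∀ j, IsSymbol m s (a' j) := fun j => (ha' j).mono (by linarith)
  have ha2 : ∀ j, IsSymbol m s (a'' j) := fun j => (ha'' j).mono (by linarith)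
  refine ⟨_, (ha.smul (-(m ^ 2 : ℝ) : ℂ)).add (IsSymbol.sum Finset.univ ha2).neg, fun φ => ?_⟩
  rw [(ha.moderateGrowth hm).integral_mul_harmonic hm (fun j => (ha1 j).moderateGrowth hm)
    (fun j => (ha2 j).moderateGrowth hm) h' h'']
  refine integral_congr_ae (Filter.Eventually.of_forall fun ξ => ?_)
  simp only [Finset.sum_sub_distrib]
  congr 1
  rw [EuclideanSpace.norm_sq_eq]
  push_cast
  simp only [add_mul, Finset.sum_mul, Real.norm_eq_abs]
  have : ∀ j, (ξ j : ℂ) * ((ξ j : ℂ) * a ξ) = ((|ξ j| : ℝ) : ℂ) ^ 2 * a ξ := fun j => by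
    rw [← Complex.ofReal_pow, sq_abs, Complex.ofReal_pow]
    ring
  simp only [this]
  ring

end IsSymbol

/-- Each application of the oscillator multiplies by `|ξ|² + m²` up to an error `-m² a - Δa`, which
is two orders below the product. The leading term therefore stays explicit, as the necessity
argument requires. -/
lemma exists_integral_base_mul_harmonic_iterate {d : ℕ} {m : ℝ} (hm : 0 < m) (α : ℝ) (q : ℕ) :
    ∃ r : Rd d → ℂ, IsSymbol m (2 * (q - α) - 2) r ∧ ∀ φ : 𝓢(Rd d, ℂ),
      ∫ ξ, (((‖ξ‖ ^ 2 + m ^ 2) ^ (-α) : ℝ) : ℂ) * harmonic^[q] φ ξ =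
      ∫ ξ, ((((‖ξ‖ ^ 2 + m ^ 2) ^ (-(α - q)) : ℝ) : ℂ) + r ξ) * φ ξ := by
  induction q with
  | zero => exact ⟨_, IsSymbol.zero _, fun φ => by simp⟩
  | succ q ih =>
    obtain ⟨r, hr, h⟩ := ih
    have hu : IsSymbol m (2 * (q - α)) fun ξ : Rd d =>
        (((‖ξ‖ ^ 2 + m ^ 2) ^ (-(α - q)) : ℝ) : ℂ) + r ξ := by
      refine IsSymbol.add ?_ (hr.mono (by linarith))
      have := IsSymbol.base (d := d) (m := m) (α - q)
      rwa [show -2 * (α - q) = 2 * (q - α) by ring] at this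
    obtain ⟨r', hr', h'⟩ := hu.exists_integral_mul_harmonic hm
    refine ⟨fun ξ => ((‖ξ‖ ^ 2 + m ^ 2 : ℝ) : ℂ) * r ξ + r' ξ, ?_, fun φ => ?_⟩
    · refine IsSymbol.add (hr.norm_sq_add_mul.mono ?_) (hr'.mono ?_) <;> push_cast <;> linarith
    · rw [Function.iterate_succ_apply, h, h']
      refine integral_congr_ae (Filter.Eventually.of_forall fun ξ => ?_)
      have hp := norm_sq_add_pos hm ξ
      have e : (‖ξ‖ ^ 2 + m ^ 2) ^ (-(α - ((q + 1 : ℕ) : ℝ))) =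
          (‖ξ‖ ^ 2 + m ^ 2) * (‖ξ‖ ^ 2 + m ^ 2) ^ (-(α - q)) := by
        rw [show -(α - ((q + 1 : ℕ) : ℝ)) = 1 + -(α - q) by push_cast; ring,
          Real.rpow_add hp, Real.rpow_one]
      simp only [e]
      push_cast
      ring

/-! ### Families of modulated symbols -/

/-- The families `y ↦ (ξ ↦ e^{-i⟨ξ, y⟩} ∑ c(y) a(ξ))` with symbols `a` of order `s` and continuous
coefficients `c`. -/
inductive IsSymbolFamily {d : ℕ} (m s : ℝ) : (Rd d → Rd d → ℂ) → Prop
  | base {c : Rd d → ℂ} (hc : Continuous c) {a : Rd d → ℂ} (ha : IsSymbol m s a) :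
      IsSymbolFamily m s fun y ξ =>
        c y * (Complex.exp (-Complex.I * ((inner ℝ ξ y : ℝ) : ℂ)) * a ξ)
  | add {v w : Rd d → Rd d → ℂ} (hv : IsSymbolFamily m s v) (hw : IsSymbolFamily m s w) :
      IsSymbolFamily m s fun y ξ => v y ξ + w y ξ

lemma norm_exp_neg_I_mul_ofReal (t : ℝ) : ‖Complex.exp (-Complex.I * (t : ℂ))‖ = 1 := by
  rw [Complex.norm_exp]
  simp

lemma hasLineDerivAt_exp_inner {d : ℕ} (j : Fin d) (y ξ : Rd d) :
    HasLineDerivAt ℝ (fun ξ => Complex.exp (-Complex.I * ((inner ℝ ξ y : ℝ) : ℂ)))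
      (-Complex.I * (y j : ℂ) * Complex.exp (-Complex.I * ((inner ℝ ξ y : ℝ) : ℂ))) ξ
      (stdVec j) := by
  unfold HasLineDerivAt
  have h0 : ∀ t : ℝ, inner ℝ (ξ + t • stdVec j) y = inner ℝ ξ y + t * y j := fun t => by
    rw [inner_add_left, real_inner_smul_left, real_inner_comm y (stdVec j), inner_stdVec]
  have h1 : HasDerivAt (fun t : ℝ => inner ℝ ξ y + t * y j) (y j) 0 := by
    simpa using ((hasDerivAt_id (0 : ℝ)).mul_const (y j)).const_add (inner ℝ ξ y)
  have h2 := (h1.ofReal_comp.const_mul (-Complex.I)).cexp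
  simp only [h0]
  refine h2.congr_deriv ?_
  simp only [zero_mul, add_zero]
  ring

namespace IsSymbolFamily

variable {d : ℕ} {m s t : ℝ} {v w : Rd d → Rd d → ℂ}

lemma mono (hst : s ≤ t) (hv : IsSymbolFamily m s v) : IsSymbolFamily m t v := by
  induction hv with
  | base hc ha => exact IsSymbolFamily.base hc (ha.mono hst)
  | add _ _ ihv ihw => exact ihv.add ihw

lemma zero (m s : ℝ) : IsSymbolFamily (d := d) m s fun _ _ => 0 := by
  simpa using IsSymbolFamily.base (c := fun _ => 0) continuous_const (IsSymbol.zero (m := m) s)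

lemma neg (hv : IsSymbolFamily m s v) : IsSymbolFamily m s fun y ξ => -v y ξ := by
  induction hv with
  | base hc ha =>
    have := IsSymbolFamily.base hc ha.neg
    simpa only [mul_neg] using this
  | add _ _ ihv ihw => simpa only [neg_add] using ihv.add ihw

lemma coord (hv : IsSymbolFamily m s v) (j : Fin d) :
    IsSymbolFamily m (s + 1) fun y ξ => (ξ j : ℂ) * v y ξ := by
  induction hv with
  | base hc ha =>
    have := IsSymbolFamily.base hc (ha.coord j)
    convert this using 3
    ring
  | add _ _ ihv ihw => simpa only [mul_add] using ihv.add ihw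

lemma sum {ι : Type*} (I : Finset ι) {f : ι → Rd d → Rd d → ℂ}
    (hf : ∀ i, IsSymbolFamily m s (f i)) : IsSymbolFamily m s fun y ξ => ∑ i ∈ I, f i y ξ := by
  classical
  induction I using Finset.induction_on with
  | empty => simpa using IsSymbolFamily.zero m s
  | insert i I hi ih =>
    simp only [Finset.sum_insert hi]
    exact (hf i).add ih

lemma continuous_right (hm : 0 < m) (hv : IsSymbolFamily m s v) (y : Rd d) : Continuous (v y) := by
  induction hv with
  | base hc ha =>
    have := (ha.moderateGrowth hm).1
    fun_prop
  | add _ _ ihv ihw => exact ihv.add ihw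

lemma continuous_left (hv : IsSymbolFamily m s v) (ξ : Rd d) : Continuous fun y => v y ξ := by
  induction hv with
  | base hc ha => fun_prop
  | add _ _ ihv ihw => exact ihv.add ihw

/-- The phase has modulus one, so `y` enters only through the coefficients. Continuity of `C` makes
the bound locally uniform in `y`, as needed for dominated convergence. -/
lemma exists_bound (hm : 0 < m) (hv : IsSymbolFamily m s v) :
    ∃ C : Rd d → ℝ, Continuous C ∧ ∀ y ξ, ‖v y ξ‖ ≤ C y * (‖ξ‖ ^ 2 + m ^ 2) ^ (s / 2) := by
  induction hv with
  | @base c hc a ha =>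
    obtain ⟨-, C, hC⟩ := ha.moderateGrowth hm
    refine ⟨fun y => ‖c y‖ * C, by fun_prop, fun y ξ => ?_⟩
    rw [norm_mul, norm_mul, norm_exp_neg_I_mul_ofReal, one_mul, mul_assoc]
    exact mul_le_mul_of_nonneg_left (hC ξ) (norm_nonneg _)
  | add _ _ ihv ihw =>
    obtain ⟨C, hc, hC⟩ := ihv
    obtain ⟨C', hc', hC'⟩ := ihw
    refine ⟨fun y => C y + C' y, hc.add hc', fun y ξ => (norm_add_le _ _).trans ?_⟩
    rw [add_mul]
    exact add_le_add (hC y ξ) (hC' y ξ)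

lemma moderateGrowth (hm : 0 < m) (hv : IsSymbolFamily m s v) (y : Rd d) :
    ModerateGrowth m s (v y) := by
  obtain ⟨C, -, hC⟩ := hv.exists_bound hm
  exact ⟨hv.continuous_right hm y, C y, hC y⟩

/-- Unlike for plain symbols the order is only preserved: the derivative of the phase brings out `-i
y_j`, which is absorbed into the coefficient. -/
lemma exists_hasLineDerivAt (hm : 0 < m) (hv : IsSymbolFamily m s v) (j : Fin d) :
    ∃ v', IsSymbolFamily m s v' ∧ ∀ y ξ, HasLineDerivAt ℝ (v y) (v' y ξ) ξ (stdVec j) := by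
  induction hv with
  | @base c hc a ha =>
    obtain ⟨a', ha', h'⟩ := ha.exists_hasLineDerivAt hm j
    have h1 : Continuous fun y : Rd d => c y * (-Complex.I * (y j : ℂ)) := by fun_prop
    refine ⟨_, (IsSymbolFamily.base h1 ha).add (IsSymbolFamily.base hc (ha'.mono (by linarith))),
      fun y ξ => ?_⟩
    have h2 := HasDerivAt.const_mul (c y)
      (hasLineDerivAt_mul (hasLineDerivAt_exp_inner j y ξ) (h' ξ))
    refine HasDerivAt.congr_deriv h2 ?_
    ring
  | add _ _ ihv ihw =>
    obtain ⟨v', hv', h'⟩ := ihv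
    obtain ⟨w', hw', h''⟩ := ihw
    exact ⟨_, hv'.add hw', fun y ξ => HasDerivAt.add (h' y ξ) (h'' y ξ)⟩

lemma exists_integral_mul_harmonic (hm : 0 < m) (hv : IsSymbolFamily m s v) :
    ∃ w, IsSymbolFamily m (s + 2) w ∧ ∀ (y : Rd d) (φ : 𝓢(Rd d, ℂ)),
      ∫ ξ, v y ξ * harmonic φ ξ = ∫ ξ, w y ξ * φ ξ := by
  choose v' hv' h' using fun j => hv.exists_hasLineDerivAt hm j
  choose v'' hv'' h'' using fun j => (hv' j).exists_hasLineDerivAt hm j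
  refine ⟨fun y ξ => ∑ j, ((ξ j : ℂ) * ((ξ j : ℂ) * v y ξ) + -v'' j y ξ),
    IsSymbolFamily.sum _ fun j => ?_, fun y φ => ?_⟩
  · refine IsSymbolFamily.add ?_ ((hv'' j).neg.mono (by linarith))
    have := (hv.coord j).coord j
    rwa [show s + 1 + 1 = s + 2 by ring] at this
  · simp only [← sub_eq_add_neg]
    exact (hv.moderateGrowth hm y).integral_mul_harmonic hm
      (fun j => (hv' j).moderateGrowth hm y) (fun j => (hv'' j).moderateGrowth hm y)
      (fun j => h' j y) (fun j => h'' j y) φ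

lemma exists_integral_mul_harmonic_iterate (hm : 0 < m) (hv : IsSymbolFamily m s v) (q : ℕ) :
    ∃ w, IsSymbolFamily m (s + 2 * q) w ∧ ∀ (y : Rd d) (φ : 𝓢(Rd d, ℂ)),
      ∫ ξ, v y ξ * harmonic^[q] φ ξ = ∫ ξ, w y ξ * φ ξ := by
  induction q with
  | zero => exact ⟨v, by simpa using hv, fun y φ => rfl⟩
  | succ q ih =>
    obtain ⟨w, hw, h⟩ := ih
    obtain ⟨w', hw', h'⟩ := hw.exists_integral_mul_harmonic hm
    refine ⟨w', hw'.mono (le_of_eq (by push_cast; ring)), fun y φ => ?_⟩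
    rw [Function.iterate_succ_apply, h, h']

end IsSymbolFamily

lemma maternSymbol_eq {d : ℕ} (α : ℝ) {m : ℝ} (ξ : Rd d) :
    maternSymbol d α m ξ = (((‖ξ‖ ^ 2 + m ^ 2) ^ (-α) : ℝ) : ℂ) := by
  rw [maternSymbol, Real.rpow_neg (by positivity), one_div]

lemma isSymbolFamily_translateSymbol (d : ℕ) (α m : ℝ) :
    IsSymbolFamily m (-2 * α) (translateSymbol d α m) := by
  have := IsSymbolFamily.base (d := d) (c := fun _ => 1) continuous_const (IsSymbol.base (m := m) α)
  convert this using 2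
  funext ξ
  rw [one_mul, translateSymbol, maternSymbol_eq]

/-! ### Square integrability -/

/-- Comparison with powers of `1 + |ξ|²`, using `|ξ|² + m² ≥ min(1, m²) (1 + |ξ|²)` and `s ≤ 0`. -/
lemma integrable_norm_sq_add_rpow {d : ℕ} {m : ℝ} (hm : 0 < m) {s : ℝ} (hs : 2 * s < -d) :
    Integrable fun ξ : Rd d => (‖ξ‖ ^ 2 + m ^ 2) ^ s := by
  have h1 := integrable_rpow_neg_one_add_norm_sq (E := Rd d) (μ := volume) (r := -2 * s) (by
    rw [finrank_euclideanSpace_fin]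
    linarith)
  have h2 : ∀ ξ : Rd d, (‖ξ‖ ^ 2 + m ^ 2) ^ s ≤ (min 1 (m ^ 2)) ^ s * (1 + ‖ξ‖ ^ 2) ^ s := by
    intro ξ
    have hmin : 0 < min 1 (m ^ 2) := lt_min one_pos (by positivity)
    rw [← Real.mul_rpow hmin.le (by positivity)]
    refine Real.rpow_le_rpow_of_nonpos (by positivity) ?_ (by
      have : (0 : ℝ) ≤ d := Nat.cast_nonneg d
      linarith)
    have := min_le_left 1 (m ^ 2)
    have := min_le_right 1 (m ^ 2)
    nlinarith [sq_nonneg ‖ξ‖]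
  rw [show -(-2 * s) / 2 = s by ring] at h1
  refine (h1.const_mul (min 1 (m ^ 2) ^ s)).mono' ?_ (Filter.Eventually.of_forall fun ξ => ?_)
  · exact (Measurable.aestronglyMeasurable (by fun_prop))
  · rw [Real.norm_of_nonneg (Real.rpow_nonneg (norm_sq_add_pos hm ξ).le _)]
    exact h2 ξ

lemma ModerateGrowth.memLp {d : ℕ} {m s : ℝ} {u : Rd d → ℂ} (hm : 0 < m)
    (hu : ModerateGrowth m s u) (hs : 2 * s < -d) : MemLp u 2 := by
  obtain ⟨hc, C, hC⟩ := hu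
  rw [memLp_two_iff_integrable_sq_norm hc.aestronglyMeasurable]
  refine ((integrable_norm_sq_add_rpow hm hs).const_mul (C ^ 2)).mono'
    (by fun_prop) (Filter.Eventually.of_forall fun ξ => ?_)
  rw [norm_pow, norm_norm]
  refine (pow_le_pow_left₀ (norm_nonneg _) (hC ξ) 2).trans (le_of_eq ?_)
  rw [mul_pow, ← Real.rpow_natCast (_ ^ (s / 2)), ← Real.rpow_mul (norm_sq_add_pos hm ξ).le]
  norm_num

/-! ### Functionals on Schwartz functions bounded in `L²` -/

/-- Schwartz functions are dense in `L²`, so `T` extends, and the Riesz representation applies; the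
pairing here is bilinear, hence the conjugate of the Riesz vector. -/
lemma exists_memLp_of_bound {d : ℕ} (T : 𝓢(Rd d, ℂ) →ₗ[ℂ] ℂ) (C : ℝ)
    (hT : ∀ φ, ‖T φ‖ ≤ C * ‖schwartzL2 φ‖) :
    ∃ g : Rd d → ℂ, MemLp g 2 ∧ ∀ φ : 𝓢(Rd d, ℂ), T φ = ∫ x, g x * φ x := by
  have hd : DenseRange (toLpCLM ℂ ℂ 2 (volume : Measure (Rd d))).toLinearMap :=
    denseRange_toLpCLM (by simp)
  set w := (InnerProductSpace.toDual ℂ (Lp ℂ 2 (volume : Measure (Rd d)))).symm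
    (T.extendOfNorm (toLpCLM ℂ ℂ 2 (volume : Measure (Rd d))).toLinearMap) with hw
  refine ⟨fun x => starRingEnd ℂ (w x), (Lp.memLp w).star, fun φ => ?_⟩
  have h1 := LinearMap.extendOfNorm_eq (f := T)
    (e := (toLpCLM ℂ ℂ 2 (volume : Measure (Rd d))).toLinearMap) hd ⟨C, hT⟩ φ
  rw [← h1, ← InnerProductSpace.toDual_symm_apply, ← hw, L2.inner_def]
  refine integral_congr_ae ?_
  filter_upwards [coeFn_schwartzL2 φ] with x hx
  have : ((toLpCLM ℂ ℂ 2 (volume : Measure (Rd d))).toLinearMap φ : Rd d → ℂ) x = φ x := hx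
  rw [this, RCLike.inner_apply, mul_comm]

/-! ### Representation of the translates by real functions -/

lemma memLp_star {d : ℕ} {g : Rd d → ℂ} (hg : MemLp g 2) :
    MemLp (fun x => starRingEnd ℂ (g x)) 2 := hg.star

/-- The class in `L²` of the complex conjugate of `g`. -/
def conjL2 {d : ℕ} {g : Rd d → ℂ} (hg : MemLp g 2) : Lp ℂ 2 (volume : Measure (Rd d)) :=
  (memLp_star hg).toLp _

lemma integral_mul_eq_inner {d : ℕ} {g : Rd d → ℂ} (hg : MemLp g 2) (φ : 𝓢(Rd d, ℂ)) :
    ∫ x, g x * φ x = inner ℂ (conjL2 hg) (schwartzL2 φ) := by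
  rw [L2.inner_def]
  refine integral_congr_ae ?_
  filter_upwards [coeFn_schwartzL2 φ, (memLp_star hg).coeFn_toLp] with x hx hx'
  rw [conjL2, hx, hx', RCLike.inner_apply, RCLike.conj_conj, mul_comm]

/-- The complex conjugate of a Schwartz function. -/
def conjSchwartz {d : ℕ} (φ : 𝓢(Rd d, ℂ)) : 𝓢(Rd d, ℂ) :=
  φ.postcompCLM (Complex.conjCLE : ℂ →L[ℝ] ℂ)

lemma conjSchwartz_apply {d : ℕ} (φ : 𝓢(Rd d, ℂ)) (x : Rd d) :
    conjSchwartz φ x = starRingEnd ℂ (φ x) := rfl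

lemma fourierInvSchwartz_conjSchwartz {d : ℕ} (φ : 𝓢(Rd d, ℂ)) (ξ : Rd d) :
    fourierInvSchwartz d (conjSchwartz φ) ξ = starRingEnd ℂ (fourierInvSchwartz d φ (-ξ)) := by
  rw [fourierInvSchwartz_apply, fourierInvSchwartz_apply, map_mul, ← Complex.ofReal_inv,
    Complex.conj_ofReal, ← integral_conj]
  congr 1
  refine integral_congr_ae (Filter.Eventually.of_forall fun x => ?_)
  simp only [conjSchwartz_apply, map_mul, ← Complex.exp_conj, Complex.conj_I, Complex.conj_ofReal,
    inner_neg_right]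
  push_cast
  ring_nf

lemma translateSymbol_neg {d : ℕ} (α m : ℝ) (y ξ : Rd d) :
    translateSymbol d α m y (-ξ) = starRingEnd ℂ (translateSymbol d α m y ξ) := by
  simp only [translateSymbol, maternSymbol, map_mul, ← Complex.exp_conj, Complex.conj_I,
    Complex.conj_ofReal, inner_neg_left, norm_neg, map_neg]
  push_cast
  ring_nf

/-- The distribution is real because its symbol takes conjugate values at `ξ` and `-ξ`. -/
lemma translate_reflect_maternKernel_conjSchwartz {d : ℕ} (α m : ℝ) (hm : 0 < m) (y : Rd d)
    (φ : 𝓢(Rd d, ℂ)) :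
    translate y (reflect (maternKernel d α m hm)) (conjSchwartz φ) =
      starRingEnd ℂ (translate y (reflect (maternKernel d α m hm)) φ) := by
  rw [translate_reflect_maternKernel_apply, translate_reflect_maternKernel_apply,
    ← integral_neg_eq_self, ← integral_conj]
  refine integral_congr_ae (Filter.Eventually.of_forall fun ξ => ?_)
  simp only [fourierInvSchwartz_conjSchwartz, neg_neg, translateSymbol_neg, map_mul]

/-- A real distribution represented by a square integrable function is represented by a real one. -/
lemma exists_real_representative {d : ℕ} {T : 𝓢(Rd d, ℂ) → ℂ}
    (hT : ∀ φ, T (conjSchwartz φ) = starRingEnd ℂ (T φ)) {g : Rd d → ℂ} (hg : MemLp g 2)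
    (h : ∀ φ : 𝓢(Rd d, ℂ), T φ = ∫ x, g x * φ x) :
    ∃ f : Lp ℝ 2 (volume : Measure (Rd d)), ∀ φ : 𝓢(Rd d, ℂ),
      T φ = ∫ x, φ x * ((f x : ℝ) : ℂ) := by
  have hre : MemLp (fun x => (g x).re) 2 := hg.re
  refine ⟨hre.toLp _, fun φ => ?_⟩
  have hi : ∀ {u : Rd d → ℂ}, MemLp u 2 → Integrable fun x => u x * φ x := fun hu =>
    hu.integrable_mul (φ.memLp 2)
  -- By reality of `T` the conjugate of `g` represents it too, hence so does the average, which is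
  -- the real part.
  have h1 : ∫ x, starRingEnd ℂ (g x) * φ x = T φ := by
    have h3 := congrArg (starRingEnd ℂ) (h (conjSchwartz φ))
    rw [hT, Complex.conj_conj, ← integral_conj] at h3
    rw [h3]
    refine integral_congr_ae (Filter.Eventually.of_forall fun x => ?_)
    simp [conjSchwartz_apply]
  have h4 : ∫ x, φ x * ((hre.toLp _ x : ℝ) : ℂ) =
      ∫ x, (1 / 2 : ℂ) * (g x * φ x + starRingEnd ℂ (g x) * φ x) := by
    refine integral_congr_ae ?_
    filter_upwards [hre.coeFn_toLp] with x hx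
    rw [hx, Complex.re_eq_add_conj]
    ring
  rw [h4, integral_const_mul, integral_add (hi hg) (hi (memLp_star hg)), h1, ← h]
  ring

lemma two_mul_lt_neg_of_lt {d q : ℕ} {α : ℝ} (hα : (d : ℝ) / 4 + q < α) :
    2 * (-2 * α + 2 * q) < -(d : ℝ) := by linarith

lemma memLp_translateSymbol {d q : ℕ} {α m : ℝ} (hm : 0 < m) (hα : (d : ℝ) / 4 + q < α)
    (y : Rd d) : MemLp (translateSymbol d α m y) 2 :=
  ((isSymbolFamily_translateSymbol d α m).moderateGrowth hm y).memLp hm (by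
    have : (0 : ℝ) ≤ q := Nat.cast_nonneg q
    linarith)

lemma norm_schwartzL2_fourierInvSchwartz {d : ℕ} (φ : 𝓢(Rd d, ℂ)) :
    ‖schwartzL2 (fourierInvSchwartz d φ)‖ =
      Real.sqrt (((2 * Real.pi) ^ d)⁻¹) * ‖schwartzL2 φ‖ := by
  have hpi := Real.pi_pos
  rw [← Real.sqrt_sq (norm_nonneg (schwartzL2 (fourierInvSchwartz d φ))),
    norm_schwartzL2_fourierInvSchwartz_sq, Real.sqrt_mul (by positivity),
    Real.sqrt_sq (norm_nonneg _)]

/-- The symbol is itself square integrable, so Cauchy–Schwarz and Parseval bound the distribution in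
the `L²` norm of the test function. -/
lemma exists_representative {d q : ℕ} {α m : ℝ} (hm : 0 < m) (hα : (d : ℝ) / 4 + q < α)
    (y : Rd d) : ∃ f : Lp ℝ 2 (volume : Measure (Rd d)), ∀ φ : 𝓢(Rd d, ℂ),
      translate y (reflect (maternKernel d α m hm)) φ = ∫ x, φ x * ((f x : ℝ) : ℂ) := by
  have hu := memLp_translateSymbol hm hα y
  set T : 𝓢(Rd d, ℂ) →L[ℂ] ℂ := translate y (reflect (maternKernel d α m hm))
  obtain ⟨g, hg, h⟩ := exists_memLp_of_bound T.toLinearMap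
    (‖conjL2 hu‖ * Real.sqrt (((2 * Real.pi) ^ d)⁻¹)) fun φ => by
      have : T.toLinearMap φ = _ := translate_reflect_maternKernel_apply α m hm y φ
      rw [this, integral_mul_eq_inner hu, mul_assoc, ← norm_schwartzL2_fourierInvSchwartz]
      exact norm_inner_le_norm _ _
  exact exists_real_representative
    (T := fun φ => translate y (reflect (maternKernel d α m hm)) φ)
    (translate_reflect_maternKernel_conjSchwartz α m hm y) hg h

/-! ### Hermite coefficients -/

lemma ofReal_hermiteCoeff {d : ℕ} (a : Fin d → ℕ) (f : Lp ℝ 2 (volume : Measure (Rd d))) :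
    ((hermiteCoeff a f : ℝ) : ℂ) = ∫ x, hermiteSchwartz a x * ((f x : ℝ) : ℂ) := by
  rw [hermiteCoeff, L2.inner_def, ← integral_complex_ofReal]
  refine integral_congr_ae ?_
  filter_upwards [(memLp_hermiteTensor a).coeFn_toLp] with x hx
  rw [hermiteL2, hx, hermiteSchwartz_apply]
  simp

/-- The weighted Hermite coefficients are inner products with the functions `ℱ⁻¹ h_a`. -/
lemma weight_pow_mul_hermiteCoeff {d q : ℕ} {α m : ℝ} (hm : 0 < m)
    {v : Rd d → Rd d → ℂ} (hv : ∀ (y : Rd d) (φ : 𝓢(Rd d, ℂ)),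
      ∫ ξ, translateSymbol d α m y ξ * harmonic^[q] φ ξ = ∫ ξ, v y ξ * φ ξ)
    {y : Rd d} (hvy : MemLp (v y) 2) {f : Lp ℝ 2 (volume : Measure (Rd d))}
    (hf : ∀ φ : 𝓢(Rd d, ℂ), translate y (reflect (maternKernel d α m hm)) φ =
      ∫ x, φ x * ((f x : ℝ) : ℂ)) (a : Fin d → ℕ) :
    ((hermiteWeight a ^ q * hermiteCoeff a f : ℝ) : ℂ) =
      inner ℂ (conjL2 hvy) (schwartzL2 (fourierInvSchwartz d (hermiteSchwartz a))) := by
  -- The weight is absorbed as the `q`-th power of the oscillator on `h_a`, which passes through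
  -- `ℱ⁻¹` and then onto the symbol by parts.
  rw [← integral_mul_eq_inner, ← hv, ← fourierInvSchwartz_harmonic_iterate,
    harmonic_iterate_hermiteSchwartz, ← translate_reflect_maternKernel_apply α m hm, map_smul, hf,
    Complex.ofReal_mul, ofReal_hermiteCoeff, smul_eq_mul, Complex.ofReal_pow]

/-- Bessel's inequality for the functions `ℱ⁻¹ h_a`. -/
lemma bessel_fourierInvSchwartz {d : ℕ} (V : Lp ℂ 2 (volume : Measure (Rd d))) :
    (Summable fun a : Fin d → ℕ =>
      ‖inner ℂ V (schwartzL2 (fourierInvSchwartz d (hermiteSchwartz a)))‖ ^ 2) ∧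
    ∑' a : Fin d → ℕ, ‖inner ℂ V (schwartzL2 (fourierInvSchwartz d (hermiteSchwartz a)))‖ ^ 2 ≤
      ((2 * Real.pi) ^ d)⁻¹ * ‖V‖ ^ 2 := by
  have hpi := Real.pi_pos
  have ho := orthonormal_fourierInvSchwartz_hermite d
  have h1 : ∀ a : Fin d → ℕ, ‖inner ℂ (((Real.sqrt ((2 * Real.pi) ^ d) : ℝ) : ℂ) •
      schwartzL2 (fourierInvSchwartz d (hermiteSchwartz a))) V‖ ^ 2 = (2 * Real.pi) ^ d *
      ‖inner ℂ V (schwartzL2 (fourierInvSchwartz d (hermiteSchwartz a)))‖ ^ 2 := fun a => by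
    rw [norm_inner_symm, inner_smul_right, norm_mul, Complex.norm_real,
      Real.norm_of_nonneg (Real.sqrt_nonneg _), mul_pow, Real.sq_sqrt (by positivity)]
  have hs := ho.inner_products_summable V
  have ht := ho.tsum_inner_products_le V
  simp only [h1] at hs ht
  have hc : (2 * Real.pi) ^ d ≠ 0 := by positivity
  refine ⟨(summable_mul_left_iff hc).1 hs, ?_⟩
  rw [tsum_mul_left] at ht
  rwa [le_inv_mul_iff₀ (by positivity)]

/-! ### Continuity -/

lemma IsSymbolFamily.tendsto_conjL2 {d : ℕ} {m s : ℝ} (hm : 0 < m) {v : Rd d → Rd d → ℂ}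
    (hv : IsSymbolFamily m s v) (hs : 2 * s < -d) (hL : ∀ y, MemLp (v y) 2) (y₀ : Rd d) :
    Filter.Tendsto (fun y => ‖conjL2 (hL y) - conjL2 (hL y₀)‖) (𝓝 y₀) (𝓝 0) := by
  obtain ⟨C, hC, hb⟩ := hv.exists_bound hm
  have h1 : ∀ y, ‖conjL2 (hL y) - conjL2 (hL y₀)‖ ^ 2 = ∫ ξ, ‖v y ξ - v y₀ ξ‖ ^ 2 := by
    intro y
    rw [← inner_self_eq_norm_sq (𝕜 := ℂ), L2.inner_def, ← integral_re]
    · refine integral_congr_ae ?_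
      filter_upwards [Lp.coeFn_sub (conjL2 (hL y)) (conjL2 (hL y₀)),
        (memLp_star (hL y)).coeFn_toLp, (memLp_star (hL y₀)).coeFn_toLp] with ξ h h' h''
      rw [h, Pi.sub_apply, conjL2, conjL2, h', h'', inner_self_eq_norm_sq, ← map_sub,
        RCLike.norm_conj]
    · exact L2.integrable_inner _ _
  have h2 : Filter.Tendsto (fun y => ∫ ξ, ‖v y ξ - v y₀ ξ‖ ^ 2) (𝓝 y₀)
      (𝓝 (∫ ξ : Rd d, ‖v y₀ ξ - v y₀ ξ‖ ^ 2)) := by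
    -- Near `y₀` both `C y` and `C y₀` are at most `|C y₀| + 1`, so the difference is at most twice
    -- this times the common power; squaring doubles the exponent `s/2`.
    refine tendsto_integral_filter_of_dominated_convergence
      (fun ξ => (2 * (|C y₀| + 1)) ^ 2 * (‖ξ‖ ^ 2 + m ^ 2) ^ s)
      (Filter.Eventually.of_forall fun y => ?_) ?_
      ((integrable_norm_sq_add_rpow hm hs).const_mul _) (Filter.Eventually.of_forall fun ξ => ?_)
    · have := hv.continuous_right hm y
      have := hv.continuous_right hm y₀
      exact Continuous.aestronglyMeasurable (by fun_prop)
    · have h3 : ∀ᶠ y in 𝓝 y₀, C y < |C y₀| + 1 :=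
        hC.continuousAt.eventually_lt continuousAt_const (by
          have := le_abs_self (C y₀)
          linarith)
      filter_upwards [h3] with y hy
      refine Filter.Eventually.of_forall fun ξ => ?_
      have hp := norm_sq_add_pos hm ξ
      have hp' : 0 ≤ (‖ξ‖ ^ 2 + m ^ 2) ^ (s / 2) := Real.rpow_nonneg hp.le _
      have e : (‖ξ‖ ^ 2 + m ^ 2) ^ s = ((‖ξ‖ ^ 2 + m ^ 2) ^ (s / 2)) ^ 2 := by
        rw [← Real.rpow_natCast (_ ^ (s / 2)), ← Real.rpow_mul hp.le]
        norm_num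
      rw [norm_pow, norm_norm, e, ← mul_pow]
      refine pow_le_pow_left₀ (norm_nonneg _) ((norm_sub_le _ _).trans ?_) 2
      have h4 := (hb y ξ).trans (mul_le_mul_of_nonneg_right hy.le hp')
      have h5 := (hb y₀ ξ).trans (mul_le_mul_of_nonneg_right
        ((le_abs_self (C y₀)).trans (le_add_of_nonneg_right zero_le_one)) hp')
      linarith
    · have := hv.continuous_left ξ
      exact Continuous.tendsto (by fun_prop) y₀
  simp only [sub_self, norm_zero, ne_eq, OfNat.ofNat_ne_zero, not_false_eq_true, zero_pow,
    integral_zero, ← h1] at h2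
  have h3 := h2.sqrt
  simpa [Real.sqrt_sq (norm_nonneg _)] using h3

/-- If `α > d/4 + q`, the translates of the Matérn kernel form a continuous map into `𝒮_q`. -/
theorem translatesContinuous_of_lt {d q : ℕ} {α m : ℝ} (hm : 0 < m)
    (hα : (d : ℝ) / 4 + q < α) : TranslatesContinuous d q α m hm := by
  obtain ⟨v, hv, hvi⟩ :=
    (isSymbolFamily_translateSymbol d α m).exists_integral_mul_harmonic_iterate hm q
  have hs := two_mul_lt_neg_of_lt hα
  have hL : ∀ y, MemLp (v y) 2 := fun y => (hv.moderateGrowth hm y).memLp hm hs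
  choose f hf using exists_representative hm hα
  have hcoeff := fun y => weight_pow_mul_hermiteCoeff hm hvi (hL y) (hf y)
  have hsq : ∀ y (a : Fin d → ℕ), hermiteWeight a ^ (2 * q) * hermiteCoeff a (f y) ^ 2 =
      ‖inner ℂ (conjL2 (hL y)) (schwartzL2 (fourierInvSchwartz d (hermiteSchwartz a)))‖ ^ 2 := by
    intro y a
    rw [← hcoeff, Complex.norm_real, Real.norm_eq_abs, sq_abs]
    ring
  have hmem : ∀ y, f y ∈ hermiteSubmodule d q := fun y =>
    (bessel_fourierInvSchwartz (conjL2 (hL y))).1.congr fun a => (hsq y a).symm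
  let F : Rd d → HermiteSobolev d q := fun y => ⟨f y, hmem y⟩
  have hF : ∀ y, (F y).toL2 = f y := fun y => rfl
  refine ⟨F, fun y φ => hf y φ, ?_⟩
  rw [continuous_iff_continuousAt]
  intro y₀
  rw [ContinuousAt, tendsto_iff_norm_sub_tendsto_zero]
  have hle : ∀ y, ‖F y - F y₀‖ ≤ ‖conjL2 (hL y) - conjL2 (hL y₀)‖ := by
    intro y
    refine le_of_sq_le_sq ?_ (norm_nonneg _)
    rw [HermiteSobolev.norm_sq]
    -- The weighted coefficients depend additively on the `L²` vectors, so those of `F y - F y₀`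
    -- come from the difference vector and Bessel's inequality applies to it; its constant
    -- `(2π)^{-d} ≤ 1` is dropped.
    have h1 : ∀ a : Fin d → ℕ,
        hermiteWeight a ^ (2 * q) * hermiteCoeff a (F y - F y₀).toL2 ^ 2 =
        ‖inner ℂ (conjL2 (hL y) - conjL2 (hL y₀))
          (schwartzL2 (fourierInvSchwartz d (hermiteSchwartz a)))‖ ^ 2 := by
      intro a
      rw [inner_sub_left, ← hcoeff, ← hcoeff, ← Complex.ofReal_sub, Complex.norm_real,
        Real.norm_eq_abs, sq_abs, map_sub, hF, hF, hermiteCoeff, inner_sub_left]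
      simp only [hermiteCoeff]
      ring
    simp only [h1]
    refine (bessel_fourierInvSchwartz _).2.trans ?_
    refine mul_le_of_le_one_left (sq_nonneg _) (inv_le_one_of_one_le₀ (one_le_pow₀ ?_))
    have := Real.pi_gt_three
    linarith
  exact squeeze_zero (fun _ => norm_nonneg _) hle (hv.tendsto_conjL2 hm hs hL y₀)

/-! ### Necessity -/

/-- The harmonic oscillator is symmetric on Schwartz functions. -/
lemma integral_mul_harmonic_comm {d : ℕ} (φ ψ : 𝓢(Rd d, ℂ)) :
    ∫ x, φ x * harmonic ψ x = ∫ x, harmonic φ x * ψ x := by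
  have hi : ∀ u w : 𝓢(Rd d, ℂ), Integrable fun x => u x * w x := fun u w =>
    (u.memLp 2).integrable_mul (w.memLp 2)
  have hIBP : ∀ j : Fin d, ∫ x, φ x * (∂_{stdVec j} (∂_{stdVec j} ψ) : 𝓢(Rd d, ℂ)) x =
      ∫ x, (∂_{stdVec j} (∂_{stdVec j} φ) : 𝓢(Rd d, ℂ)) x * ψ x := fun j => by
    rw [integral_mul_lineDerivOp_right_eq_neg_left, integral_mul_lineDerivOp_right_eq_neg_left,
      neg_neg]
  have e1 : ∀ x, φ x * harmonic ψ x = ∑ j : Fin d, (φ x * coordMul j (coordMul j ψ) x -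
      φ x * (∂_{stdVec j} (∂_{stdVec j} ψ) : 𝓢(Rd d, ℂ)) x) := fun x => by
    simp only [harmonic_apply, Finset.mul_sum, coordMul_apply]
    exact Finset.sum_congr rfl fun j _ => by ring
  have e2 : ∀ x, harmonic φ x * ψ x = ∑ j : Fin d, (φ x * coordMul j (coordMul j ψ) x -
      (∂_{stdVec j} (∂_{stdVec j} φ) : 𝓢(Rd d, ℂ)) x * ψ x) := fun x => by
    simp only [harmonic_apply, Finset.sum_mul, coordMul_apply]
    exact Finset.sum_congr rfl fun j _ => by ring
  simp only [e1, e2]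
  refine (integral_finsetSum _ fun j _ => (hi _ _).sub (hi _ _)).trans
    (Eq.trans ?_ (integral_finsetSum _ fun j _ => (hi _ _).sub (hi _ _)).symm)
  refine Finset.sum_congr rfl fun j _ => ?_
  refine (integral_sub (hi _ _) (hi _ _)).trans
    (Eq.trans ?_ (integral_sub (hi _ _) (hi _ _)).symm)
  rw [hIBP]

lemma integral_mul_harmonic_iterate_comm {d : ℕ} (q : ℕ) (φ ψ : 𝓢(Rd d, ℂ)) :
    ∫ x, φ x * harmonic^[q] ψ x = ∫ x, harmonic^[q] φ x * ψ x := by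
  induction q generalizing φ with
  | zero => rfl
  | succ q ih =>
    rw [Function.iterate_succ_apply', integral_mul_harmonic_comm, ih, ← Function.iterate_succ_apply]

lemma inner_hermiteLp_schwartzL2 {d : ℕ} (a : Fin d → ℕ) (φ : 𝓢(Rd d, ℂ)) :
    inner ℂ (hermiteLp a) (schwartzL2 φ) = ∫ x, hermiteSchwartz a x * φ x := by
  rw [hermiteLp, inner_schwartzL2]
  refine integral_congr_ae (Filter.Eventually.of_forall fun x => ?_)
  simp only [RCLike.inner_apply, hermiteSchwartz_apply, Complex.conj_ofReal, mul_comm]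

lemma inner_hermiteLp_harmonic_iterate {d : ℕ} (q : ℕ) (a : Fin d → ℕ) (φ : 𝓢(Rd d, ℂ)) :
    inner ℂ (hermiteLp a) (schwartzL2 (harmonic^[q] φ)) =
      (hermiteWeight a : ℂ) ^ q * inner ℂ (hermiteLp a) (schwartzL2 φ) := by
  rw [inner_hermiteLp_schwartzL2, inner_hermiteLp_schwartzL2, integral_mul_harmonic_iterate_comm,
    harmonic_iterate_hermiteSchwartz, ← integral_const_mul]
  refine integral_congr_ae (Filter.Eventually.of_forall fun x => ?_)
  simp only [smul_apply, smul_eq_mul, mul_assoc]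

/-- For `f ∈ 𝒮_q` the distribution `(|x|² - Δ)^q f` is square integrable. -/
lemma exists_bound_integral_harmonic_iterate {d q : ℕ} (f : HermiteSobolev d q) :
    ∃ C : ℝ, ∀ φ : 𝓢(Rd d, ℂ),
      ‖∫ x, harmonic^[q] φ x * ((f.toL2 x : ℝ) : ℂ)‖ ≤ C * ‖schwartzL2 φ‖ := by
  have hf : MemLp (fun x => ((f.toL2 x : ℝ) : ℂ)) 2 := (Lp.memLp f.toL2).ofReal
  have hpair : ∀ φ : 𝓢(Rd d, ℂ), ∫ x, φ x * ((f.toL2 x : ℝ) : ℂ) =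
      inner ℂ (conjL2 hf) (schwartzL2 φ) := fun φ => by
    rw [← integral_mul_eq_inner]
    exact integral_congr_ae (Filter.Eventually.of_forall fun x => mul_comm _ _)
  have hcoeff : ∀ a, inner ℂ (conjL2 hf) (hermiteLp a) = ((hermiteCoeff a f.toL2 : ℝ) : ℂ) :=
    fun a => by rw [ofReal_hermiteCoeff, hpair, hermiteLp]
  have hb : Memℓp (fun a : Fin d → ℕ =>
      ((hermiteWeight a ^ q * hermiteCoeff a f.toL2 : ℝ) : ℂ)) 2 := by
    refine memℓp_gen (f.summable.congr fun a => ?_)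
    rw [Complex.norm_real, ENNReal.toReal_ofNat, Real.rpow_ofNat, Real.norm_eq_abs, sq_abs]
    ring
  -- The candidate for `H^q f`: membership in `𝒮_q` says that the weighted coefficients are square
  -- summable, and completeness supplies a vector that has them.
  set g := (hermiteBasis d).repr.symm ⟨_, hb⟩ with hg
  have hgc : ∀ a, inner ℂ g (hermiteBasis d a) =
      ((hermiteWeight a ^ q * hermiteCoeff a f.toL2 : ℝ) : ℂ) := fun a => by
    rw [← inner_conj_symm, ← HilbertBasis.repr_apply_apply, hg, LinearIsometryEquiv.apply_symm_apply]
    exact Complex.conj_ofReal _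
  refine ⟨‖g‖, fun φ => ?_⟩
  -- Expand in the basis, shift the weight from the coefficients of the test function to those of
  -- `f`, and resum to an inner product with `g`.
  rw [hpair, ← (hermiteBasis d).tsum_inner_mul_inner]
  have h1 : ∀ a, inner ℂ (conjL2 hf) (hermiteBasis d a) *
      inner ℂ (hermiteBasis d a) (schwartzL2 (harmonic^[q] φ)) =
      inner ℂ g (hermiteBasis d a) * inner ℂ (hermiteBasis d a) (schwartzL2 φ) := fun a => by
    rw [hgc, hermiteBasis_apply, hcoeff, inner_hermiteLp_harmonic_iterate]
    push_cast
    ring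
  simp only [h1]
  rw [(hermiteBasis d).tsum_inner_mul_inner]
  exact norm_inner_le_norm _ _

/-- The Riesz representative of the pairing with `u` is square integrable, and it agrees with `u`
almost everywhere since both are locally integrable. -/
lemma ModerateGrowth.memLp_of_bound {d : ℕ} {m s : ℝ} (hm : 0 < m) {u : Rd d → ℂ}
    (hu : ModerateGrowth m s u) (C : ℝ)
    (h : ∀ φ : 𝓢(Rd d, ℂ), ‖∫ ξ, u ξ * φ ξ‖ ≤ C * ‖schwartzL2 φ‖) : MemLp u 2 := by
  let T : 𝓢(Rd d, ℂ) →ₗ[ℂ] ℂ :=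
    { toFun := fun φ => ∫ ξ, u ξ * φ ξ
      map_add' := fun φ ψ => by
        rw [← integral_add (hu.integrable_mul hm φ) (hu.integrable_mul hm ψ)]
        exact integral_congr_ae (Filter.Eventually.of_forall fun ξ => by
          simp only [add_apply, mul_add])
      map_smul' := fun c φ => by
        rw [RingHom.id_apply, smul_eq_mul, ← integral_const_mul]
        exact integral_congr_ae (Filter.Eventually.of_forall fun ξ => by
          simp only [smul_apply, smul_eq_mul, mul_left_comm]) }
  obtain ⟨g, hg, hT⟩ := exists_memLp_of_bound T C h
  refine (memLp_congr_ae ?_).2 hg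
  refine ae_eq_of_integral_schwartz hu.1.locallyIntegrable (hg.locallyIntegrable (by norm_num))
    fun φ => ?_
  have : ∫ ξ, u ξ * φ ξ = ∫ ξ, g ξ * φ ξ := hT φ
  simpa only [mul_comm] using this

/-- A function comparable to `(|ξ|² + m²)^{-β}` at infinity is square integrable only if
`4 β > d`. -/
lemma lt_of_memLp_add {d : ℕ} (hd : 1 ≤ d) {m β : ℝ} (hm : 0 < m) {r : Rd d → ℂ}
    (hr : ModerateGrowth m (-2 * β - 2) r)
    (h : MemLp (fun ξ => (((‖ξ‖ ^ 2 + m ^ 2) ^ (-β) : ℝ) : ℂ) + r ξ) 2) : (d : ℝ) < 4 * β := by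
  by_contra! hβ
  obtain ⟨hrc, C, hC⟩ := hr
  rw [memLp_two_iff_integrable_sq_norm h.1] at h
  -- For `|ξ| > R` one has `2|C| ≤ |ξ|² + m²`, so the remainder is at most half the leading term.
  -- The summand `m` gives `t² + m² ≤ 2t²` for `t > R`, and the summand `1` keeps the base above
  -- `1`.
  set R : ℝ := 1 + m + 2 * |C| with hR
  have hR1 : 1 ≤ R := by have := abs_nonneg C; linarith
  have hRC : 2 * |C| ≤ R := by linarith
  have hRm : m ≤ R := by have := abs_nonneg C; linarith
  let f : ℝ → ℝ := (Set.Ioi R).indicator fun t => (t ^ 2 + m ^ 2) ^ (-2 * β)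
  have hfm : Measurable f := Measurable.indicator (by fun_prop) measurableSet_Ioi
  -- Outside the ball the leading term is at most twice the modulus of the sum; squaring gives the
  -- factor `4`.
  have hint : Integrable fun ξ : Rd d => f ‖ξ‖ := by
    refine (h.const_mul 4).mono' (hfm.comp measurable_norm).aestronglyMeasurable
      (Filter.Eventually.of_forall fun ξ => ?_)
    by_cases hξ : ‖ξ‖ ∈ Set.Ioi R
    · simp only [f, Set.indicator_of_mem hξ]
      have hξ' : R < ‖ξ‖ := hξ
      have hp := norm_sq_add_pos hm ξ
      have hb : 0 ≤ (‖ξ‖ ^ 2 + m ^ 2) ^ (-β) := Real.rpow_nonneg hp.le _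
      have h1 : |C| * (‖ξ‖ ^ 2 + m ^ 2) ^ (-β - 1) ≤ (‖ξ‖ ^ 2 + m ^ 2) ^ (-β) / 2 := by
        rw [Real.rpow_sub_one hp.ne', mul_div_assoc', div_le_iff₀ hp]
        have : 2 * |C| ≤ ‖ξ‖ ^ 2 + m ^ 2 := by nlinarith [sq_nonneg m]
        nlinarith
      have h2 : ‖r ξ‖ ≤ (‖ξ‖ ^ 2 + m ^ 2) ^ (-β) / 2 := by
        refine (hC ξ).trans (le_trans ?_ h1)
        rw [show (-2 * β - 2) / 2 = -β - 1 by ring]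
        exact mul_le_mul_of_nonneg_right (le_abs_self C) (Real.rpow_nonneg hp.le _)
      have h3 : (‖ξ‖ ^ 2 + m ^ 2) ^ (-β) / 2 ≤
          ‖(((‖ξ‖ ^ 2 + m ^ 2) ^ (-β) : ℝ) : ℂ) + r ξ‖ := by
        have h4 := norm_sub_le ((((‖ξ‖ ^ 2 + m ^ 2) ^ (-β) : ℝ) : ℂ) + r ξ) (r ξ)
        rw [add_sub_cancel_right, Complex.norm_real, Real.norm_of_nonneg hb] at h4
        linarith
      have h5 : (‖ξ‖ ^ 2 + m ^ 2) ^ (-2 * β) = ((‖ξ‖ ^ 2 + m ^ 2) ^ (-β)) ^ 2 := by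
        rw [← Real.rpow_natCast (_ ^ (-β)), ← Real.rpow_mul hp.le]
        congr 1
        push_cast
        ring
      rw [Real.norm_of_nonneg (Real.rpow_nonneg hp.le _), h5]
      nlinarith
    · simp only [f, Set.indicator_of_notMem hξ, norm_zero]
      positivity
  have : Nonempty (Fin d) := ⟨⟨0, hd⟩⟩
  rw [integrable_fun_norm_addHaar, finrank_euclideanSpace_fin] at hint
  have hint2 : IntegrableOn (fun t : ℝ => t ^ (d - 1) • f t) (Set.Ioi R) :=
    hint.mono_set (Set.Ioi_subset_Ioi (by linarith))
  -- If `4β ≤ d`, the radial integrand `t^{d-1} (t² + m²)^{-2β}` is at least `2^{-d/2} t⁻¹`, whose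
  -- integral diverges at infinity.
  have hinv : IntegrableOn (fun t : ℝ => t ^ (-1 : ℝ)) (Set.Ioi R) := by
    refine (hint2.const_mul ((2 : ℝ) ^ ((d : ℝ) / 2))).mono'
      (Measurable.aestronglyMeasurable (by fun_prop))
      ((ae_restrict_iff' measurableSet_Ioi).2 (Filter.Eventually.of_forall fun t ht => ?_))
    have ht' : R < t := ht
    have ht0 : 0 < t := by linarith
    simp only [f, Set.indicator_of_mem ht, smul_eq_mul]
    rw [Real.norm_of_nonneg (Real.rpow_nonneg ht0.le _)]
    have h1 : (t ^ 2 + m ^ 2) ^ (-((d : ℝ) / 2)) ≤ (t ^ 2 + m ^ 2) ^ (-2 * β) :=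
      Real.rpow_le_rpow_of_exponent_le (by nlinarith) (by linarith)
    have h2 : (2 * t ^ 2) ^ (-((d : ℝ) / 2)) ≤ (t ^ 2 + m ^ 2) ^ (-((d : ℝ) / 2)) :=
      Real.rpow_le_rpow_of_nonpos (by positivity) (by nlinarith)
        (by have : (0 : ℝ) ≤ d := Nat.cast_nonneg d
            linarith)
    have h3 : t ^ (-1 : ℝ) = (2 : ℝ) ^ ((d : ℝ) / 2) *
        (t ^ (d - 1) * (2 * t ^ 2) ^ (-((d : ℝ) / 2))) := by
      rw [Real.mul_rpow (by norm_num) (by positivity), ← Real.rpow_natCast t 2,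
        ← Real.rpow_mul ht0.le, ← Real.rpow_natCast t (d - 1), mul_left_comm (t ^ _), ← mul_assoc,
        ← Real.rpow_add two_pos, ← Real.rpow_add ht0, add_neg_cancel, Real.rpow_zero, one_mul,
        Nat.cast_sub hd]
      congr 1
      push_cast
      ring
    rw [h3]
    gcongr
    exact h2.trans h1
  exact lt_irrefl _ ((integrableOn_Ioi_rpow_iff (by linarith)).1 hinv)

/-- If all translates of the Matérn kernel lie in `𝒮_q`, then `α > d/4 + q`. -/
theorem lt_of_translatesMem {d q : ℕ} (hd : 1 ≤ d) {α m : ℝ} (hm : 0 < m)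
    (h : TranslatesMem d q α m hm) : (d : ℝ) / 4 + q < α := by
  -- At the origin there is no phase, so derivatives really lower the order and the remainder stays
  -- below the leading term.
  obtain ⟨f, hf⟩ := h 0
  obtain ⟨C, hC⟩ := exists_bound_integral_harmonic_iterate f
  obtain ⟨r, hr, hri⟩ := exists_integral_base_mul_harmonic_iterate (d := d) hm α q
  have hr' : IsSymbol m (-2 * (α - q) - 2) r := by
    rwa [show -2 * (α - q) - 2 = 2 * (q - α) - 2 by ring]
  have hG : ModerateGrowth m (-2 * (α - q)) fun ξ : Rd d =>
      (((‖ξ‖ ^ 2 + m ^ 2) ^ (-(α - q)) : ℝ) : ℂ) + r ξ :=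
    ((IsSymbol.base (α - q)).add (hr'.mono (by linarith))).moderateGrowth hm
  have hpi := Real.pi_pos
  have hL := hG.memLp_of_bound hm (|C| * Real.sqrt ((2 * Real.pi) ^ d)) fun φ => by
    -- Every test function on the Fourier side is some `ℱ⁻¹ χ`, which turns the bound for `H^q f`
    -- into one for the symbol; the factor `√((2π)^d)` undoes Parseval's constant.
    obtain ⟨χ, rfl⟩ := fourierInvSchwartz_surjective d φ
    have h1 : ∀ ξ : Rd d, (((‖ξ‖ ^ 2 + m ^ 2) ^ (-α) : ℝ) : ℂ) = translateSymbol d α m 0 ξ :=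
      fun ξ => by simp [translateSymbol, maternSymbol_eq]
    rw [← hri, ← fourierInvSchwartz_harmonic_iterate]
    simp only [h1]
    rw [← translate_reflect_maternKernel_apply α m hm, hf, norm_schwartzL2_fourierInvSchwartz,
      mul_assoc, ← mul_assoc (Real.sqrt _), ← Real.sqrt_mul (by positivity),
      mul_inv_cancel₀ (by positivity), Real.sqrt_one, one_mul]
    exact (hC χ).trans (mul_le_mul_of_nonneg_right (le_abs_self C) (norm_nonneg _))
  have := lt_of_memLp_add hd hm (hr'.moderateGrowth hm) hL
  linarith

end MaternHermite

end

theorem lemma2p7 (d q : ℕ) (hd : 1 ≤ d) (α m : ℝ) (hm : 0 < m) :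
    ((d : ℝ) / 4 + q + max 0 (((q : ℝ) - 3) / 2) < α →
        MaternHermite.TranslatesContinuous d q α m hm) ∧
    (MaternHermite.TranslatesContinuous d q α m hm → MaternHermite.TranslatesMem d q α m hm) ∧
    (MaternHermite.TranslatesMem d q α m hm → (d : ℝ) / 4 + q < α) ∧
    (q ≤ 3 →
      (MaternHermite.TranslatesContinuous d q α m hm ↔ MaternHermite.TranslatesMem d q α m hm) ∧
      (MaternHermite.TranslatesMem d q α m hm ↔ (d : ℝ) / 4 + q < α)) := by
  have h42 : (d : ℝ) / 4 + q < α → MaternHermite.TranslatesContinuous d q α m hm :=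
    MaternHermite.translatesContinuous_of_lt hm
  have h23 : MaternHermite.TranslatesContinuous d q α m hm →
      MaternHermite.TranslatesMem d q α m hm := fun ⟨F, hF, _⟩ y => ⟨F y, hF y⟩
  have h34 : MaternHermite.TranslatesMem d q α m hm → (d : ℝ) / 4 + q < α :=
    MaternHermite.lt_of_translatesMem hd hm
  refine ⟨fun h => h42 (lt_of_le_of_lt (le_add_of_nonneg_right (le_max_left _ _)) h), h23, h34,
    fun _ => ⟨⟨h23, fun h => h42 (h34 h)⟩, h34, fun h => h23 (h42 h)⟩⟩
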